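/- Let $f:\mathbb{Z}_{\ge 2}\to\mathbb{R}$ be a function with $2\le f(n)\le 4\log n$ for every integer $n\ge 2$, and for an integer $q\ge 2$ put \[ \mathcal{B}_f(q):=\Big\{s=\sigma+it\in\mathbb{C} \;:\; \sigma>1-\frac{1}{f(q)},\ |t|<\frac{1}{\sqrt{f(q)}}\Big\}. \] Let $\chi$ be a primitive Dirichlet character modulo $q$, and let $\varrho(\chi)$ be the multiset of non-trivial zeros of $L(s,\chi)$, that is, of the zeros with $0<\mathrm{Re}(s)<1$, counted with multiplicity. Then $\varrho(\chi)\cap\mathcal{B}_f(q)$ is finite and \[ \Bigg|\mathrm{Re}\Bigg(\frac{L'}{L}(1,\chi)-\sum_{\varrho\in\varrho(\chi)\cap\mathcal{B}_f(q)}\frac{1}{1-\varrho}\Bigg)\Bigg| < \Big(14.5+2\,\big|\varrho(\chi)\cap\mathcal{B}_f(q)\big|\Big)\sqrt{f(q)\log q}, \] where both the sum and the cardinality count zeros with multiplicity. -/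

import Mathlib

/-- The set of non-trivial zeros of `L(s, χ)`: the zeros in the open critical strip `0 < σ < 1`.
Multiplicities are recorded separately by `zeroMultiplicity`. -/
def nontrivialZeros {q : ℕ} [NeZero q] (χ : DirichletCharacter ℂ q) : Set ℂ :=
  {s : ℂ | 0 < s.re ∧ s.re < 1 ∧ DirichletCharacter.LFunction χ s = 0}

/-- The multiplicity of `ρ` as a zero of `L(s, χ)`: the order of vanishing there. -/
noncomputable def zeroMultiplicity {q : ℕ} [NeZero q] (χ : DirichletCharacter ℂ q) (ρ : ℂ) : ℕ :=
  analyticOrderNatAt (DirichletCharacter.LFunction χ) ρ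

/-- The region `B_f(q)` of all `s = σ + it` with `σ > 1 - 1 / f(q)` and `|t| < 1 / √(f(q))`. -/
def regionB (f : ℕ → ℝ) (q : ℕ) : Set ℂ :=
  {s : ℂ | 1 - 1 / f q < s.re ∧ |s.im| < 1 / Real.sqrt (f q)}

/-! Let Λ be the completed L-function of χ; it is entire and its zeros are the non-trivial zeros of
L. For real x ≥ 1, Re Λ'/Λ(x) + (log q)/2 = Σ_ρ Re 1/(x - ρ), summed over growing discs about 1/2
(`IsPrimitive.tendsto_sum_zeros_re`), and every term is nonnegative. No Hadamard product is needed: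
Λ has order at most 3/2, so dividing out the zeros of a large disc leaves a factor whose logarithmic
derivative is nearly constant (`tendsto_sum_zeros_logDeriv`), and the functional equation fixes the
real part of the constant.

Put δ = 1/√(f log q) and compare the points 1 and 1 + δ. Zeros outside the box change their
contribution little (`abs_one_div_sub_re_sub_le`): the change is at most δ f Re 1/(1+δ-ρ) to the
left of the box and 2δ√f Re 1/(1+1/√f-ρ) above or below it. By positivity the sum of these is
controlled by the identity at 1 + δ and 1 + 1/√f, where L'/L is bounded through ζ'/ζ
(`norm_logDeriv_LFunction_le`). For zeros in the box the terms at 1 are those subtracted in the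
theorem, and the terms at 1 + δ are at most 1/δ each. What remains is L'/L(1+δ) and a bounded change
of the gamma factor. As f ≤ 4 log q, every error is O(√(f log q)); `error_terms_lt` checks the
constant. -/

open Filter Topology Metric MeasureTheory ComplexConjugate

/-! ### Entire functions of order less than two: zeros and logarithmic derivatives. -/

/-- A normalised logarithm of an entire function without zeros in a ball. -/
lemma exists_log_on_ball {h : ℂ → ℂ} (hh : Differentiable ℂ h) {a : ℂ} {R : ℝ} (hR : 0 < R)
    (h0 : ∀ z ∈ ball a R, h z ≠ 0) :
    ∃ g : ℂ → ℂ, g a = 0 ∧ (∀ z ∈ ball a R, HasDerivAt g (logDeriv h z) z) ∧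
      ∀ z ∈ ball a R, h z = h a * Complex.exp (g z) := by
  have hd : DifferentiableOn ℂ (logDeriv h) (ball a R) := by
    intro z hz
    exact ((hh.analyticAt z).deriv.differentiableAt.div (hh z) (h0 z hz)).differentiableWithinAt
  obtain ⟨g, hga, hg⟩ := hd.isExactOn_ball.with_val_at a 0
  refine ⟨g, hga, hg, fun z hz => ?_⟩
  have key : ∀ w ∈ ball a R, HasDerivAt (fun w => h w * Complex.exp (-g w)) 0 w := by
    intro w hw
    have := (hh w).hasDerivAt.mul (hg w hw).neg.cexp
    refine this.congr_deriv ?_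
    rw [logDeriv_apply]
    field_simp [h0 w hw]
    ring
  have hconst : h z * Complex.exp (-g z) = h a * Complex.exp (-g a) := by
    refine isOpen_ball.is_const_of_deriv_eq_zero (convex_ball a R).isPreconnected
      (fun w hw => (key w hw).differentiableAt.differentiableWithinAt)
      (fun w hw => (key w hw).deriv) hz (mem_ball_self hR)
  rw [hga, neg_zero, Complex.exp_zero, mul_one, Complex.exp_neg] at hconst
  rw [← hconst]
  field_simp [Complex.exp_ne_zero]

/-- If an entire function has no zeros in a large ball and does not grow too much there, then its
logarithmic derivative is nearly constant close to the centre. -/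
lemma norm_logDeriv_sub_le {h : ℂ → ℂ} (hh : Differentiable ℂ h) {a : ℂ} {R A : ℝ} (hR : 0 < R)
    (hA : 0 < A) (h0 : ∀ z ∈ ball a R, h z ≠ 0)
    (hb : ∀ z ∈ ball a R, ‖h z‖ ≤ Real.exp A * ‖h a‖) {w : ℂ} (hw : w ∈ ball a (R / 4)) :
    ‖logDeriv h w - logDeriv h a‖ ≤ 128 * A / R ^ 2 * ‖w - a‖ := by
  obtain ⟨g, hga, hg, hgh⟩ := exists_log_on_ball hh hR h0
  have ha0 : 0 < ‖h a‖ := norm_pos_iff.2 (h0 a (mem_ball_self hR))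
  have hre : ∀ z ∈ ball a R, (g z).re ≤ A := by
    intro z hz
    have h1 := hb z hz
    rw [hgh z hz, norm_mul, Complex.norm_exp, mul_comm] at h1
    exact Real.exp_le_exp.1 (le_of_mul_le_mul_right h1 ha0)
  -- Borel–Carathéodory bounds `g` from its real part. Two Cauchy estimates of radius `R / 8` then
  -- bound `g'` on radius `3R/8` and `g''` on radius `R/4`.
  have hbc : ∀ z ∈ ball a (R / 2), ‖g z‖ ≤ 2 * A := by
    intro z hz
    rw [mem_ball, dist_eq_norm] at hz
    have := Complex.borelCaratheodory_zero (f := fun u => g (a + u)) (z := z - a) (R := R) hA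
      (fun u hu => by
        have : HasDerivAt g (logDeriv h (a + u)) (a + u) := hg _ (by simpa using hu)
        exact (this.comp_const_add a u).differentiableAt.differentiableWithinAt)
      (fun u hu => hre _ (by simpa using hu)) hR (by simp; linarith) (by simpa using hga)
    simp only [add_sub_cancel] at this
    refine this.trans ?_
    rw [div_le_iff₀ (by linarith)]
    nlinarith
  have h1 : ∀ z ∈ ball a (3 * R / 8), ‖logDeriv h z‖ ≤ 16 * A / R := by
    intro z hz
    rw [mem_ball] at hz
    have hsub : closedBall z (R / 8) ⊆ ball a (R / 2) := by
      intro u hu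
      rw [mem_closedBall] at hu
      rw [mem_ball]
      have := dist_triangle u z a
      linarith
    have hz' : z ∈ ball a R := by rw [mem_ball]; linarith
    have hdc : DiffContOnCl ℂ g (ball z (R / 8)) := by
      refine DifferentiableOn.diffContOnCl fun u hu => ?_
      rw [closure_ball z (by positivity)] at hu
      exact (hg u (ball_subset_ball (by linarith) (hsub hu))).differentiableAt.differentiableWithinAt
    have := Complex.norm_deriv_le_of_forall_mem_sphere_norm_le (by positivity : 0 < R / 8) hdc
      (C := 2 * A) (fun u hu => hbc u (hsub (sphere_subset_closedBall hu)))
    rw [(hg z hz').deriv] at this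
    refine this.trans (le_of_eq ?_)
    field_simp
    norm_num
  have hd : ∀ z ∈ ball a R, DifferentiableAt ℂ (logDeriv h) z := fun z hz =>
    (hh.analyticAt z).deriv.differentiableAt.div (hh z) (h0 z hz)
  have h2 : ∀ z ∈ ball a (R / 4), ‖deriv (logDeriv h) z‖ ≤ 128 * A / R ^ 2 := by
    intro z hz
    rw [mem_ball] at hz
    have := Complex.norm_deriv_le_of_forall_mem_sphere_norm_le (f := logDeriv h) (c := z)
      (by positivity : 0 < R / 8) (C := 16 * A / R)
      (DifferentiableOn.diffContOnCl fun u hu => (hd u ?_).differentiableWithinAt) ?_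
    · refine this.trans (le_of_eq ?_)
      field_simp
      norm_num
    · rw [closure_ball z (by positivity), mem_closedBall] at hu
      rw [mem_ball]
      have := dist_triangle u z a
      linarith
    · intro u hu
      refine h1 u ?_
      rw [mem_sphere] at hu
      rw [mem_ball]
      have := dist_triangle u z a
      linarith
  exact (convex_ball a (R / 4)).norm_image_sub_le_of_norm_deriv_le
    (fun z hz => hd z (ball_subset_ball (by linarith) hz)) h2 (mem_ball_self (by positivity)) hw

/-- An entire function that does not vanish identically is a product of linear factors and an entire
function without zeros on a given finite set. -/
lemma exists_eq_prod_mul {F : ℂ → ℂ} (hF : Differentiable ℂ F) (hF0 : F ≠ 0) (Z : Finset ℂ) :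
    ∃ h : ℂ → ℂ, Differentiable ℂ h ∧ (∀ ρ ∈ Z, h ρ ≠ 0) ∧
      F = fun z => (∏ ρ ∈ Z, (z - ρ) ^ analyticOrderNatAt F ρ) * h z := by
  induction Z using Finset.induction_on with
  | empty => exact ⟨F, hF, by simp, by simp⟩
  | insert ρ Z hρ ih =>
    obtain ⟨h, hh, hZ, hFh⟩ := ih
    have hne : analyticOrderAt F ρ ≠ ⊤ := fun e => hF0 <| funext fun z => by
      have := (AnalyticOnNhd.analyticOrderAt_eq_top_iff_eq_zero ρ
        (f := F) (fun z => hF.analyticAt z)).1 e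
      simp [this]
    have hPan : AnalyticAt ℂ (fun z => ∏ ρ ∈ Z, (z - ρ) ^ analyticOrderNatAt F ρ) ρ := by
      fun_prop
    have hP0 : ∏ σ ∈ Z, (ρ - σ) ^ analyticOrderNatAt F σ ≠ 0 :=
      Finset.prod_ne_zero_iff.2 fun σ hσ => pow_ne_zero _ <| sub_ne_zero.2 <| by
        rintro rfl; exact hρ hσ
    -- The factors already removed do not vanish at `ρ`, so `h` keeps the full order of `F` there.
    have hord : analyticOrderAt F ρ = analyticOrderAt h ρ := by
      conv_lhs => rw [hFh]
      have := analyticOrderAt_mul hPan (hh.analyticAt ρ)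
      rw [hPan.analyticOrderAt_eq_zero.2 hP0, zero_add] at this
      exact this
    obtain ⟨g, hg, hg0, hgh⟩ := (hh.analyticAt ρ).analyticOrderAt_ne_top.1 (hord ▸ hne)
    have hn : analyticOrderNatAt h ρ = analyticOrderNatAt F ρ := by
      rw [analyticOrderNatAt, analyticOrderNatAt, hord]
    rw [hn] at hgh
    set n := analyticOrderNatAt F ρ
    -- The quotient has a removable singularity at `ρ`, filled with the value of the local cofactor
    -- `g`.
    let k : ℂ → ℂ := Function.update (fun z => h z / (z - ρ) ^ n) ρ (g ρ)
    have hk : k =ᶠ[𝓝 ρ] g := by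
      filter_upwards [hgh] with z hz
      by_cases hzρ : z = ρ
      · simp [k, hzρ]
      · have : (z - ρ) ^ n ≠ 0 := pow_ne_zero _ (sub_ne_zero.2 hzρ)
        simp [k, Function.update_of_ne hzρ, hz, this]
    have hkd : Differentiable ℂ k := by
      intro z
      by_cases hzρ : z = ρ
      · rw [hzρ]
        exact hg.differentiableAt.congr_of_eventuallyEq hk
      · have hz : k =ᶠ[𝓝 z] fun z => h z / (z - ρ) ^ n := by
          filter_upwards [isOpen_ne.mem_nhds hzρ] with w hw
          simp [k, Function.update_of_ne hw]
        refine DifferentiableAt.congr_of_eventuallyEq ?_ hz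
        exact (hh z).div (by fun_prop) (pow_ne_zero _ (sub_ne_zero.2 hzρ))
    have hhk : ∀ z, h z = (z - ρ) ^ n * k z := by
      intro z
      by_cases hzρ : z = ρ
      · have := hgh.self_of_nhds
        simp only [smul_eq_mul] at this
        rw [hzρ, this]
        simp [k]
      · have : (z - ρ) ^ n ≠ 0 := pow_ne_zero _ (sub_ne_zero.2 hzρ)
        simp only [k, Function.update_of_ne hzρ]
        field_simp
    refine ⟨k, hkd, ?_, ?_⟩
    · intro σ hσ
      rcases Finset.mem_insert.1 hσ with rfl | hσ
      · rw [hk.self_of_nhds]; exact hg0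
      · intro h0
        exact hZ σ hσ (by rw [hhk, h0, mul_zero])
    · rw [hFh]
      funext z
      rw [Finset.prod_insert hρ, hhk z, ← hFh]
      ring

/-- A bounded set contains finitely many zeros of a non-zero entire function. -/
lemma finite_zeros_of_isBounded {F : ℂ → ℂ} (hF : Differentiable ℂ F) (hF0 : F ≠ 0) {S : Set ℂ}
    (hS : Bornology.IsBounded S) : ({z | F z = 0} ∩ S).Finite := by
  obtain ⟨x, hx⟩ := Function.ne_iff.1 hF0
  have hc := AnalyticOnNhd.preimage_zero_mem_codiscrete (f := F) (x := x)
    (fun z _ => hF.analyticAt z) hx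
  have hc' := mem_codiscrete'.1 hc
  rw [← Set.preimage_compl, compl_compl] at hc'
  obtain ⟨r, hr⟩ := hS.subset_closedBall 0
  refine Set.Finite.subset (((isCompact_closedBall (0:ℂ) r).inter_right
    (t := F ⁻¹' {0}) (isClosed_singleton.preimage hF.continuous)).finite
      (hc'.2.mono Set.inter_subset_right)) ?_
  rintro z ⟨hz, hzS⟩
  exact ⟨hr hzS, hz⟩

/-- The zero-free part of an entire function in a disc is controlled by the size of the function on
a larger circle. -/
lemma norm_cofactor_le {F h : ℂ → ℂ} (hh : Differentiable ℂ h) {Z : Finset ℂ}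
    {m : ℂ → ℕ} (hFh : F = fun z => (∏ ρ ∈ Z, (z - ρ) ^ m ρ) * h z) {c a : ℂ} {R M : ℝ}
    (hR : 0 < R) (hZ : ∀ ρ ∈ Z, ‖ρ - c‖ ≤ R) (ha : ‖a - c‖ ≤ R) (hFa : F a ≠ 0)
    (hM : ∀ z, ‖z - c‖ = 4 * R → ‖F z‖ ≤ M) {z : ℂ} (hz : z ∈ ball c (4 * R)) :
    ‖h z‖ ≤ M / ‖F a‖ * ‖h a‖ := by
  refine Complex.norm_le_of_forall_mem_frontier_norm_le isBounded_ball hh.diffContOnCl ?_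
    (subset_closure hz)
  intro u hu
  rw [frontier_ball c (by positivity), mem_sphere, dist_eq_norm] at hu
  -- On the circle `‖u - c‖ = 4R` each `‖u - ρ‖` is at least `3R`, while `‖a - ρ‖ ≤ 2R`.
  have hPle : ‖∏ ρ ∈ Z, (a - ρ) ^ m ρ‖ ≤ ‖∏ ρ ∈ Z, (u - ρ) ^ m ρ‖ := by
    rw [norm_prod, norm_prod]
    refine Finset.prod_le_prod (fun _ _ => norm_nonneg _) fun ρ hρ => ?_
    rw [norm_pow, norm_pow]
    refine pow_le_pow_left₀ (norm_nonneg _) ?_ _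
    have h1 := hZ ρ hρ
    have h2 : ‖a - ρ‖ ≤ ‖a - c‖ + ‖ρ - c‖ := by
      simpa using norm_sub_le (a - c) (ρ - c)
    have h3 : ‖u - c‖ ≤ ‖u - ρ‖ + ‖ρ - c‖ := by
      simpa using norm_add_le (u - ρ) (ρ - c)
    linarith
  have hFa' : ‖F a‖ = ‖∏ ρ ∈ Z, (a - ρ) ^ m ρ‖ * ‖h a‖ := by rw [hFh, norm_mul]
  have hFu : ‖F u‖ = ‖∏ ρ ∈ Z, (u - ρ) ^ m ρ‖ * ‖h u‖ := by rw [hFh, norm_mul]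
  have h4 := hM u hu
  have hpos : 0 < ‖F a‖ := norm_pos_iff.2 hFa
  have hPa : 0 < ‖∏ ρ ∈ Z, (a - ρ) ^ m ρ‖ := by
    rcases (norm_nonneg (∏ ρ ∈ Z, (a - ρ) ^ m ρ)).eq_or_lt with h | h
    · rw [← h, zero_mul] at hFa'; exact absurd hFa' hpos.ne'
    · exact h
  have hha : 0 < ‖h a‖ := by
    rcases (norm_nonneg (h a)).eq_or_lt with h | h
    · rw [← h, mul_zero] at hFa'; exact absurd hFa' hpos.ne'
    · exact h
  rw [hFa', div_mul_eq_mul_div, mul_div_mul_right _ _ hha.ne', le_div_iff₀ hPa]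
  calc ‖h u‖ * ‖∏ ρ ∈ Z, (a - ρ) ^ m ρ‖ ≤ ‖h u‖ * ‖∏ ρ ∈ Z, (u - ρ) ^ m ρ‖ := by gcongr
    _ ≤ M := by rw [mul_comm, ← hFu]; exact h4

lemma logDeriv_prod_mul {F h : ℂ → ℂ} (hh : Differentiable ℂ h) {Z : Finset ℂ}
    {m : ℂ → ℕ} (hFh : F = fun z => (∏ ρ ∈ Z, (z - ρ) ^ m ρ) * h z) {a : ℂ} (hFa : F a ≠ 0)
    (haZ : a ∉ Z) :
    logDeriv F a = ∑ ρ ∈ Z, (m ρ : ℂ) * (1 / (a - ρ)) + logDeriv h a := by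
  have hne : ∀ ρ ∈ Z, a - ρ ≠ 0 := fun ρ hρ => sub_ne_zero.2 <| by rintro rfl; exact haZ hρ
  have hha : h a ≠ 0 := fun h0 => hFa (by rw [hFh]; simp [h0])
  rw [hFh, logDeriv_mul a (Finset.prod_ne_zero_iff.2 fun ρ hρ => pow_ne_zero _ (hne ρ hρ)) hha
    (by fun_prop) (hh a), logDeriv_prod (f := fun ρ z => (z - ρ) ^ m ρ) (fun ρ hρ => pow_ne_zero _ (hne ρ hρ)) (by fun_prop)]
  congr 1
  refine Finset.sum_congr rfl fun ρ _ => ?_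
  rw [logDeriv_fun_pow (by fun_prop)]
  simp [logDeriv_apply]

/-- Logarithmic derivative of an entire function of order less than two, as a sum over zeros. -/
theorem tendsto_sum_zeros_logDeriv {F : ℂ → ℂ} (hF : Differentiable ℂ F) {C : ℝ} (hC : 0 ≤ C)
    (hgrowth : ∀ R : ℝ, 1 ≤ R → ∀ z, ‖z‖ ≤ R → ‖F z‖ ≤ Real.exp (C * R ^ (3 / 2 : ℝ)))
    {Z : ℕ → Finset ℂ} (hZ : ∀ n ρ, ρ ∈ Z n ↔ F ρ = 0 ∧ ‖ρ - 1 / 2‖ ≤ n)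
    {a w : ℂ} (ha : F a ≠ 0) (hw : F w ≠ 0) :
    Tendsto (fun n => ∑ ρ ∈ Z n, (analyticOrderNatAt F ρ : ℂ) * (1 / (a - ρ))
      - ∑ ρ ∈ Z n, (analyticOrderNatAt F ρ : ℂ) * (1 / (w - ρ))) atTop
      (𝓝 (logDeriv F a - logDeriv F w)) := by
  have hF0 : F ≠ 0 := fun h => ha (by rw [h]; rfl)
  set B : ℝ := |Real.log ‖F a‖| + 1 with hB
  have hBpos : 0 < B := by positivity
  -- The cofactor is bounded through the circle of radius `4n` about `1/2`, which lies in `‖u‖ ≤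
  -- 5n`; it has no zeros within `n/2` of `a`. Growth exponent `3/2` against the denominator `n²`
  -- gives convergence to 0. `B` absorbs `1 / ‖F a‖`.
  have hlim : Tendsto (fun n : ℕ => 128 * (C * (5 * (n:ℝ)) ^ (3 / 2 : ℝ) + B) / ((n:ℝ) / 2) ^ 2
      * ‖w - a‖) atTop (𝓝 0) := by
    have h1 : Tendsto (fun n : ℕ => 512 * ‖w - a‖ *
        (C * 5 ^ (3 / 2 : ℝ) * ((n:ℝ) ^ (-(1 / 2) : ℝ)) + B * ((n:ℝ) ^ (-2 : ℝ)))) atTop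
        (𝓝 (512 * ‖w - a‖ * (C * 5 ^ (3 / 2 : ℝ) * 0 + B * 0))) := by
      refine (((tendsto_rpow_neg_atTop (by norm_num)).comp
        tendsto_natCast_atTop_atTop).const_mul _ |>.add
        (((tendsto_rpow_neg_atTop (by norm_num)).comp
        tendsto_natCast_atTop_atTop).const_mul _)).const_mul _
    simp only [mul_zero, add_zero] at h1
    refine h1.congr' ?_
    filter_upwards [eventually_gt_atTop 0] with n hn
    have hn' : (0:ℝ) < n := by exact_mod_cast hn
    rw [Real.mul_rpow (by norm_num) hn'.le, Real.rpow_neg hn'.le 2,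
      show (-(1 / 2) : ℝ) = 3 / 2 - 2 by norm_num, Real.rpow_sub hn', Real.rpow_ofNat]
    field_simp
    ring
  rw [← tendsto_sub_nhds_zero_iff]
  refine squeeze_zero_norm' ?_ hlim
  filter_upwards [eventually_gt_atTop 0, eventually_ge_atTop ⌈2 * ‖a - 1 / 2‖⌉₊,
    eventually_gt_atTop ⌈8 * ‖w - a‖⌉₊] with n hn hn1 hn2
  have hn' : (1:ℝ) ≤ n := by exact_mod_cast hn
  have hn1' : 2 * ‖a - 1 / 2‖ ≤ n := (Nat.le_ceil _).trans (by exact_mod_cast hn1)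
  have hn2' : 8 * ‖w - a‖ < n := (Nat.le_ceil _).trans_lt (by exact_mod_cast hn2)
  obtain ⟨h, hh, hhZ, hFh⟩ := exists_eq_prod_mul hF hF0 (Z n)
  have haZ : a ∉ Z n := fun h => ha ((hZ n a).1 h).1
  have hwZ : w ∉ Z n := fun h => hw ((hZ n w).1 h).1
  rw [logDeriv_prod_mul hh hFh ha haZ, logDeriv_prod_mul hh hFh hw hwZ]
  rw [show ∀ x y u v : ℂ, x - y - (x + u - (y + v)) = v - u by intros; ring]
  have hsub : ∀ z ∈ ball a ((n:ℝ) / 2), ‖z - 1 / 2‖ < n := by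
    intro z hz
    rw [mem_ball, dist_eq_norm] at hz
    have : ‖z - 1 / 2‖ ≤ ‖z - a‖ + ‖a - 1 / 2‖ := by simpa using norm_add_le (z - a) (a - 1 / 2)
    linarith
  refine norm_logDeriv_sub_le hh (by positivity) (by positivity) ?_ ?_ ?_
  · intro z hz h0
    exact hhZ z ((hZ n z).2 ⟨by rw [hFh]; simp [h0], (hsub z hz).le⟩) h0
  · intro z hz
    have hz1 := hsub z hz
    have hpos : 0 < ‖F a‖ := norm_pos_iff.2 ha
    have := norm_cofactor_le hh hFh (c := 1 / 2) (R := n) (by linarith)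
      (M := Real.exp (C * (5 * (n:ℝ)) ^ (3 / 2 : ℝ)))
      (fun ρ hρ => ((hZ n ρ).1 hρ).2) (by linarith [norm_nonneg (a - 1 / 2)]) ha (fun u hu => by
        refine hgrowth _ (by linarith) _ ?_
        have : ‖u‖ ≤ ‖u - 1 / 2‖ + ‖(1 / 2 : ℂ)‖ := by simpa using norm_add_le (u - 1 / 2) (1 / 2)
        norm_num at this hu
        linarith) (z := z) (by rw [mem_ball, dist_eq_norm]; linarith)
    refine this.trans ?_
    gcongr
    rw [Real.exp_add, div_eq_mul_inv]
    gcongr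
    rw [← Real.exp_log hpos, ← Real.exp_neg, Real.exp_le_exp]
    linarith [neg_abs_le (Real.log ‖F a‖)]
  · rw [mem_ball, dist_eq_norm]
    linarith

/-! ### Growth of the completed L-function. -/

/-- An everywhere convergent Mellin transform is bounded in vertical strips. -/
lemma exists_norm_mellin_le {f : ℝ → ℂ} (hf : ∀ s, MellinConvergent f s) (a b : ℝ) :
    ∃ M : ℝ, ∀ s : ℂ, a ≤ s.re → s.re ≤ b → ‖mellin f s‖ ≤ M := by
  have hnorm : ∀ (s : ℂ), ∀ t ∈ Set.Ioi (0:ℝ), ‖(t : ℂ) ^ (s - 1) • f t‖ = t ^ (s.re - 1) * ‖f t‖ := by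
    intro s t ht
    rw [norm_smul, Complex.norm_cpow_eq_rpow_re_of_pos ht]
    simp
  have hint : ∀ c : ℝ, IntegrableOn (fun t : ℝ => t ^ (c - 1) * ‖f t‖) (Set.Ioi 0) := by
    intro c
    refine ((hf (c : ℂ)).norm).congr ?_
    refine (ae_restrict_iff' measurableSet_Ioi).2 (Eventually.of_forall fun t ht => ?_)
    simpa using hnorm c t ht
  -- For `t ≤ 1` the exponent `a` dominates, for `t ≥ 1` the exponent `b`; the sum of both serves
  -- everywhere.
  refine ⟨∫ t in Set.Ioi (0:ℝ), (t ^ (a - 1) * ‖f t‖ + t ^ (b - 1) * ‖f t‖), fun s ha hb => ?_⟩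
  refine (norm_integral_le_integral_norm _).trans ?_
  refine setIntegral_mono_on (hf s).norm ((hint a).add (hint b)) measurableSet_Ioi fun t ht => ?_
  rw [hnorm s t ht, ← add_mul]
  refine mul_le_mul_of_nonneg_right ?_ (norm_nonneg _)
  have ht0 : (0:ℝ) < t := ht
  rcases le_total t 1 with h | h
  · have h1 := Real.rpow_le_rpow_of_exponent_ge ht0 h (show a - 1 ≤ s.re - 1 by linarith)
    have := Real.rpow_nonneg ht0.le (b - 1)
    linarith
  · have h1 := Real.rpow_le_rpow_of_exponent_le h (show s.re - 1 ≤ b - 1 by linarith)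
    have := Real.rpow_nonneg ht0.le (a - 1)
    linarith

-- With the polar terms removed, the function is half the Mellin transform at `s / 2` of the
-- modified kernel, which converges everywhere. In the odd case below the kernel needs no
-- modification.
open HurwitzZeta in
lemma exists_norm_completedHurwitzZetaEven₀_le (x : UnitAddCircle) (a b : ℝ) :
    ∃ M : ℝ, ∀ s : ℂ, a ≤ s.re → s.re ≤ b → ‖completedHurwitzZetaEven₀ x s‖ ≤ M := by
  obtain ⟨M, hM⟩ := exists_norm_mellin_le (f := (hurwitzEvenFEPair x).f_modif)
    (fun s => ((hurwitzEvenFEPair x).isStrongFEPair_toStrongFEPair.hasMellin s).1) (a / 2) (b / 2)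
  refine ⟨M / 2, fun s ha hb => ?_⟩
  have := hM (s / 2) (by simp; linarith) (by simp; linarith)
  rw [completedHurwitzZetaEven₀, norm_div]
  simp only [Complex.norm_ofNat]
  exact div_le_div_of_nonneg_right this (by norm_num)

open HurwitzZeta in
lemma exists_norm_completedHurwitzZetaOdd_le (x : UnitAddCircle) (a b : ℝ) :
    ∃ M : ℝ, ∀ s : ℂ, a ≤ s.re → s.re ≤ b → ‖completedHurwitzZetaOdd x s‖ ≤ M := by
  obtain ⟨M, hM⟩ := exists_norm_mellin_le (f := (hurwitzOddFEPair x).f)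
    (fun s => ((isStrong_hurwitzOddFEPair x).hasMellin s).1) ((a + 1) / 2) ((b + 1) / 2)
  refine ⟨M / 2, fun s ha hb => ?_⟩
  have := hM ((s + 1) / 2) (by simp; linarith) (by simp; linarith)
  rw [completedHurwitzZetaOdd, norm_div, (isStrong_hurwitzOddFEPair x).Λ_eq]
  simp only [Complex.norm_ofNat]
  exact div_le_div_of_nonneg_right this (by norm_num)

/-- Completed `L`-functions of non-trivial characters are bounded in vertical strips. -/
lemma exists_norm_completedLFunction_le {q : ℕ} [NeZero q] {χ : DirichletCharacter ℂ q}
    (hχ : χ ≠ 1) (a b : ℝ) :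
    ∃ M : ℝ, ∀ s : ℂ, a ≤ s.re → s.re ≤ b → ‖DirichletCharacter.completedLFunction χ s‖ ≤ M := by
  choose M₁ hM₁ using fun x => exists_norm_completedHurwitzZetaEven₀_le x a b
  choose M₂ hM₂ using fun x => exists_norm_completedHurwitzZetaOdd_le x a b
  have hq : (1:ℝ) ≤ q := by exact_mod_cast NeZero.one_le
  have hq1 : q ≠ 1 := hχ ∘ DirichletCharacter.level_one' _
  refine ⟨(q:ℝ) ^ (-a) * ∑ j : ZMod q, ‖χ j‖ * M₁ (ZMod.toAddCircle j)
    + (q:ℝ) ^ (-a) * ∑ j : ZMod q, ‖χ j‖ * M₂ (ZMod.toAddCircle j), fun s ha hb => ?_⟩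
  -- The polar terms carry the coefficients `χ 0` and `∑ χ j`, both zero for non-trivial `χ`.
  rw [DirichletCharacter.completedLFunction, ZMod.completedLFunction_eq, χ.map_zero' hq1,
    χ.sum_eq_zero_of_ne_one hχ]
  simp only [mul_zero, zero_div, sub_zero]
  rw [ZMod.completedLFunction₀]
  have hN : ‖(q : ℂ) ^ (-s)‖ ≤ (q:ℝ) ^ (-a) := by
    rw [Complex.norm_natCast_cpow_of_pos (NeZero.pos q)]
    exact Real.rpow_le_rpow_of_exponent_le hq (by simpa using ha)
  refine (norm_add_le _ _).trans ?_
  rw [norm_mul, norm_mul]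
  gcongr
  · refine (norm_sum_le _ _).trans (Finset.sum_le_sum fun j _ => ?_)
    rw [norm_mul]
    exact mul_le_mul_of_nonneg_left (hM₁ _ s ha hb) (norm_nonneg _)
  · refine (norm_sum_le _ _).trans (Finset.sum_le_sum fun j _ => ?_)
    rw [norm_mul]
    exact mul_le_mul_of_nonneg_left (hM₂ _ s ha hb) (norm_nonneg _)

lemma Complex.norm_Gamma_le_Gamma_re {s : ℂ} (hs : 0 < s.re) :
    ‖Complex.Gamma s‖ ≤ Real.Gamma s.re := by
  rw [Complex.Gamma_eq_integral hs, Real.Gamma_eq_integral hs, Complex.GammaIntegral]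
  refine (norm_integral_le_integral_norm _).trans (le_of_eq ?_)
  refine setIntegral_congr_fun measurableSet_Ioi fun t ht => ?_
  rw [norm_mul, Complex.norm_cpow_eq_rpow_re_of_pos ht, Complex.norm_real, Real.norm_eq_abs,
    abs_of_pos (Real.exp_pos _)]
  simp

/-- A crude Stirling bound, `Γ(x) ≤ Γ(x+1) ≤ n! ≤ n^n` with `n = ⌈R⌉`, followed by `log n ≤ 2√n`.
The shift to `x + 1` reaches the range `[2, ∞)` where `Γ` increases. -/
lemma Real.Gamma_le_exp {x R : ℝ} (hx : 1 ≤ x) (hxR : x ≤ R) :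
    Real.Gamma x ≤ Real.exp (8 * R ^ (3 / 2 : ℝ)) := by
  have hx0 : 0 < x := by linarith
  have hR : 1 ≤ R := hx.trans hxR
  have hR0 : 0 < R := by linarith
  set n := ⌈R⌉₊ with hn
  have hRn : R ≤ n := Nat.le_ceil R
  have hn2 : (n : ℝ) ≤ 2 * R := by linarith [Nat.ceil_lt_add_one hR0.le]
  have h1 : Real.Gamma x ≤ Real.Gamma (x + 1) := by
    rw [Real.Gamma_add_one hx0.ne']
    nlinarith [Real.Gamma_pos_of_pos hx0]
  have h2 : Real.Gamma (x + 1) ≤ Real.Gamma (n + 1) :=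
    Real.Gamma_strictMonoOn_Ici.monotoneOn (by simp; linarith) (by simp; linarith) (by linarith)
  rw [Real.Gamma_nat_eq_factorial] at h2
  have h3 : (n.factorial : ℝ) ≤ (n:ℝ) ^ (n:ℝ) := by
    rw [Real.rpow_natCast]; exact_mod_cast Nat.factorial_le_pow n
  have hnpos : (0:ℝ) < n := by linarith
  have h4 : (n:ℝ) ^ (n:ℝ) ≤ Real.exp (8 * R ^ (3 / 2 : ℝ)) := by
    rw [Real.rpow_def_of_pos hnpos, Real.exp_le_exp]
    have hlog : Real.log n ≤ 4 * R ^ (1 / 2 : ℝ) := by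
      have h5 := Real.log_le_rpow_div hnpos.le (show (0:ℝ) < 1 / 2 by norm_num)
      have h6 : (n:ℝ) ^ (1 / 2 : ℝ) ≤ 2 * R ^ (1 / 2 : ℝ) := by
        refine (Real.rpow_le_rpow hnpos.le hn2 (by norm_num)).trans ?_
        rw [Real.mul_rpow (by norm_num) hR0.le]
        gcongr
        rw [← Real.sqrt_eq_rpow]
        rw [Real.sqrt_le_left (by norm_num)]
        norm_num
      linarith
    have hlog0 : 0 ≤ Real.log n := Real.log_nonneg (by linarith)
    have h7 : R ^ (3 / 2 : ℝ) = R * R ^ (1 / 2 : ℝ) := by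
      rw [show (3 / 2 : ℝ) = 1 + 1 / 2 by norm_num, Real.rpow_add hR0, Real.rpow_one]
    rw [h7]
    calc Real.log n * n ≤ (4 * R ^ (1 / 2 : ℝ)) * (2 * R) := by gcongr
      _ = _ := by ring
  linarith

lemma Complex.norm_Gammaℝ_le {s : ℂ} {R : ℝ} (hs : 2 ≤ s.re) (hR : s.re ≤ 2 * R) :
    ‖Complex.Gammaℝ s‖ ≤ Real.exp (8 * R ^ (3 / 2 : ℝ)) := by
  rw [Complex.Gammaℝ_def, norm_mul]
  have h1 : ‖(Real.pi : ℂ) ^ (-s / 2)‖ ≤ 1 := by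
    rw [Complex.norm_cpow_eq_rpow_re_of_pos Real.pi_pos]
    refine Real.rpow_le_one_of_one_le_of_nonpos (by linarith [Real.pi_gt_three]) ?_
    simp; linarith
  have h2 : ‖Complex.Gamma (s / 2)‖ ≤ Real.Gamma (s / 2).re :=
    Complex.norm_Gamma_le_Gamma_re (by simp; linarith)
  have h3 := Real.Gamma_le_exp (x := (s / 2).re) (R := R) (by simp; linarith) (by simp; linarith)
  calc _ ≤ 1 * Real.exp (8 * R ^ (3 / 2 : ℝ)) := by gcongr; exact h2.trans h3
    _ = _ := one_mul _

namespace DirichletCharacter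

variable {q : ℕ} [NeZero q]

omit [NeZero q] in
lemma gammaFactor_ne_zero (χ : DirichletCharacter ℂ q) {s : ℂ} (hs : 0 < s.re) :
    gammaFactor χ s ≠ 0 := by
  rcases χ.even_or_odd with h | h
  · rw [h.gammaFactor_def]
    exact Complex.Gammaℝ_ne_zero_of_re_pos hs
  · rw [h.gammaFactor_def]
    exact Complex.Gammaℝ_ne_zero_of_re_pos (by simp; linarith)

lemma completedLFunction_eq_mul {χ : DirichletCharacter ℂ q} (hχ : χ ≠ 1) {s : ℂ}
    (hs : 0 < s.re) : completedLFunction χ s = LFunction χ s * gammaFactor χ s := by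
  rw [LFunction_eq_completed_div_gammaFactor χ s (.inr (hχ ∘ level_one' _)),
    div_mul_cancel₀ _ (gammaFactor_ne_zero χ hs)]

lemma norm_LFunction_le (χ : DirichletCharacter ℂ q) {s : ℂ} (hs : 2 ≤ s.re) :
    ‖LFunction χ s‖ ≤ ∑' n, ‖LSeries.term 1 2 n‖ := by
  have h1 : Summable fun n => ‖LSeries.term (1 : ℕ → ℂ) 2 n‖ :=
    (LSeriesSummable_one_iff.2 (by norm_num)).norm
  have hle : ∀ n, ‖LSeries.term (χ ·) s n‖ ≤ ‖LSeries.term (1 : ℕ → ℂ) 2 n‖ := fun n =>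
    (LSeries.norm_term_le s (by simpa using χ.norm_le_one n)).trans
      (LSeries.norm_term_le_of_re_le_re 1 (by simpa using hs) n)
  rw [LFunction_eq_LSeries χ (by linarith)]
  exact (norm_tsum_le_tsum_norm (h1.of_nonneg_of_le (fun _ => norm_nonneg _) hle)).trans
    ((h1.of_nonneg_of_le (fun _ => norm_nonneg _) hle).tsum_le_tsum hle h1)

lemma exists_norm_completedLFunction_le_of_two_le_re {χ : DirichletCharacter ℂ q} (hχ : χ ≠ 1) :
    ∃ C : ℝ, 0 ≤ C ∧ ∀ R : ℝ, 1 ≤ R → ∀ s : ℂ, 2 ≤ s.re → ‖s‖ ≤ R →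
      ‖completedLFunction χ s‖ ≤ Real.exp (C * R ^ (3 / 2 : ℝ)) := by
  set K := ∑' n, ‖LSeries.term 1 2 n‖ with hK
  have hK0 : 0 ≤ K := tsum_nonneg fun _ => norm_nonneg _
  refine ⟨K + 8, by positivity, fun R hR s hs hsR => ?_⟩
  have hre : s.re ≤ R := (Complex.re_le_norm s).trans hsR
  have hg : ‖gammaFactor χ s‖ ≤ Real.exp (8 * R ^ (3 / 2 : ℝ)) := by
    rcases χ.even_or_odd with h | h
    · rw [h.gammaFactor_def]
      exact Complex.norm_Gammaℝ_le hs (by linarith)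
    · rw [h.gammaFactor_def]
      exact Complex.norm_Gammaℝ_le (by simp; linarith) (by simp; linarith)
  have hR1 : (1:ℝ) ≤ R ^ (3 / 2 : ℝ) := Real.one_le_rpow hR (by norm_num)
  have hK1 : K ≤ Real.exp (K * R ^ (3 / 2 : ℝ)) := by
    have := Real.add_one_le_exp (K * R ^ (3 / 2 : ℝ))
    nlinarith
  rw [completedLFunction_eq_mul hχ (by linarith), norm_mul, add_mul, Real.exp_add]
  gcongr
  exact (norm_LFunction_le χ hs).trans hK1

/-- The completed `L`-function of a primitive character has order at most `3 / 2`. -/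
lemma exists_norm_completedLFunction_le_exp {χ : DirichletCharacter ℂ q} (hχ : χ.IsPrimitive)
    (hχ1 : χ ≠ 1) :
    ∃ C : ℝ, 0 ≤ C ∧ ∀ R : ℝ, 1 ≤ R → ∀ s : ℂ, ‖s‖ ≤ R →
      ‖completedLFunction χ s‖ ≤ Real.exp (C * R ^ (3 / 2 : ℝ)) := by
  obtain ⟨C₁, hC₁, h₁⟩ := exists_norm_completedLFunction_le_of_two_le_re hχ1
  obtain ⟨C₂, hC₂, h₂⟩ := exists_norm_completedLFunction_le_of_two_le_re (inv_ne_one.2 hχ1)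
  obtain ⟨M, hM⟩ := exists_norm_completedLFunction_le hχ1 (-1) 2
  have hq : (1:ℝ) ≤ q := by exact_mod_cast NeZero.one_le
  have hlog : 0 ≤ Real.log q := Real.log_nonneg hq
  refine ⟨C₁ + (‖rootNumber χ‖ + 2 * Real.log q + 3 * C₂) + |M|, by positivity,
    fun R hR s hs => ?_⟩
  have hR1 : (1:ℝ) ≤ R ^ (3 / 2 : ℝ) := Real.one_le_rpow hR (by norm_num)
  rcases lt_or_ge s.re (-1) with h | h
  -- Left of the strip the functional equation passes to `1 - s` and `χ⁻¹`, where `Re (1 - s) > 2`;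
  -- inside `-1 ≤ σ ≤ 2` the function is bounded.
  · have hF := hχ.completedLFunction_one_sub (1 - s)
    rw [sub_sub_cancel] at hF
    have hs1 : ‖1 - s‖ ≤ 2 * R := (norm_sub_le _ _).trans (by rw [norm_one]; linarith)
    have h3 := h₂ (2 * R) (by linarith) (1 - s) (by simp; linarith) hs1
    have hre : -s.re ≤ R := (neg_le_abs _).trans ((Complex.abs_re_le_norm s).trans hs)
    have h4 : ‖(q : ℂ) ^ (1 - s - 1 / 2)‖ ≤ Real.exp (2 * Real.log q * R ^ (3 / 2 : ℝ)) := by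
      rw [Complex.norm_natCast_cpow_of_pos (NeZero.pos q), Real.rpow_def_of_pos (by linarith),
        Real.exp_le_exp]
      have h5 : (1 - s - 1 / 2 : ℂ).re ≤ 2 * R := by norm_num; linarith
      have h6 : R ≤ R ^ (3 / 2 : ℝ) := by
        simpa using Real.rpow_le_rpow_of_exponent_le hR (show (1:ℝ) ≤ 3 / 2 by norm_num)
      calc Real.log q * (1 - s - 1 / 2 : ℂ).re ≤ Real.log q * (2 * R ^ (3 / 2 : ℝ)) := by
            gcongr; linarith
        _ = _ := by ring
    have h7 : ‖rootNumber χ‖ ≤ Real.exp (‖rootNumber χ‖ * R ^ (3 / 2 : ℝ)) := by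
      have := Real.add_one_le_exp (‖rootNumber χ‖ * R ^ (3 / 2 : ℝ))
      nlinarith [norm_nonneg (rootNumber χ)]
    have h8 : C₂ * (2 * R) ^ (3 / 2 : ℝ) ≤ 3 * C₂ * R ^ (3 / 2 : ℝ) := by
      rw [Real.mul_rpow (by norm_num) (by linarith)]
      have : (2:ℝ) ^ (3 / 2 : ℝ) ≤ 3 := by
        rw [show (3 / 2 : ℝ) = 3 * (1 / 2) by norm_num, Real.rpow_mul (by norm_num),
          ← Real.sqrt_eq_rpow, Real.sqrt_le_left (by norm_num)]
        norm_num
      calc C₂ * ((2:ℝ) ^ (3 / 2 : ℝ) * R ^ (3 / 2 : ℝ)) ≤ C₂ * (3 * R ^ (3 / 2 : ℝ)) := by gcongr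
        _ = _ := by ring
    rw [hF, norm_mul, norm_mul]
    calc _ ≤ Real.exp (2 * Real.log q * R ^ (3 / 2 : ℝ)) *
          Real.exp (‖rootNumber χ‖ * R ^ (3 / 2 : ℝ)) *
          Real.exp (C₂ * (2 * R) ^ (3 / 2 : ℝ)) := by gcongr
      _ ≤ _ := by
        rw [← Real.exp_add, ← Real.exp_add, Real.exp_le_exp]
        have : 0 ≤ (C₁ + |M|) * R ^ (3 / 2 : ℝ) := by positivity
        linarith
  · rcases le_total s.re 2 with h' | h'
    · refine (hM s h h').trans ((le_abs_self M).trans ?_)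
      have h1 := Real.add_one_le_exp |M|
      refine (le_trans (by linarith) h1).trans (Real.exp_le_exp.2 ?_)
      have : 0 ≤ (C₁ + (‖rootNumber χ‖ + 2 * Real.log q + 3 * C₂)) * R ^ (3 / 2 : ℝ) := by
        positivity
      nlinarith [abs_nonneg M]
    · refine (h₁ R hR s h' hs).trans (Real.exp_le_exp.2 ?_)
      have : 0 ≤ ((‖rootNumber χ‖ + 2 * Real.log q + 3 * C₂) + |M|) * R ^ (3 / 2 : ℝ) := by
        positivity
      linarith

/-! ### Reflection in the critical line and the sum over zeros. -/

lemma conj_LFunction_conj_of_one_lt_re (χ : DirichletCharacter ℂ q) {s : ℂ} (hs : 1 < s.re) :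
    conj (LFunction χ (conj s)) = LFunction χ⁻¹ s := by
  rw [LFunction_eq_LSeries _ (by simpa using hs), LFunction_eq_LSeries _ hs, LSeries, LSeries,
    Complex.conj_tsum]
  refine tsum_congr fun n => ?_
  rcases eq_or_ne n 0 with rfl | hn
  · simp
  · rw [LSeries.term_of_ne_zero hn, LSeries.term_of_ne_zero hn, map_div₀, Complex.cpow_conj,
      Complex.conj_conj, Complex.conj_natCast, ← MulChar.star_apply']
    · rfl
    · rw [Complex.natCast_arg]
      exact Real.pi_pos.ne

lemma _root_.Complex.conj_Gammaℝ_conj (s : ℂ) :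
    conj (Complex.Gammaℝ (conj s)) = Complex.Gammaℝ s := by
  rw [Complex.Gammaℝ_def, Complex.Gammaℝ_def, map_mul, ← Complex.Gamma_conj,
    show -conj s / 2 = conj (-s / 2) by simp [map_ofNat], Complex.cpow_conj]
  · simp [map_ofNat]
  · rw [Complex.arg_ofReal_of_nonneg Real.pi_pos.le]
    exact Real.pi_pos.ne

omit [NeZero q] in
lemma conj_gammaFactor_conj (χ : DirichletCharacter ℂ q) (s : ℂ) :
    conj (gammaFactor χ (conj s)) = gammaFactor χ⁻¹ s := by
  have hinv : χ⁻¹ (-1) = (χ (-1))⁻¹ := MulChar.inv_apply_eq_inv' χ (-1)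
  rcases χ.even_or_odd with h | h
  · have h' : χ⁻¹.Even := by rw [Even, hinv, h, inv_one]
    rw [h.gammaFactor_def, h'.gammaFactor_def, Complex.conj_Gammaℝ_conj]
  · have h' : χ⁻¹.Odd := by rw [Odd, hinv, h, inv_neg_one]
    rw [h.gammaFactor_def, h'.gammaFactor_def, ← Complex.conj_Gammaℝ_conj (s + 1)]
    simp

/-- Both sides are entire and agree for `Re s > 1`. This removes `χ⁻¹` from the functional equation,
leaving a symmetry of one function. -/
lemma conj_completedLFunction_conj {χ : DirichletCharacter ℂ q} (hχ : χ ≠ 1) (s : ℂ) :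
    conj (completedLFunction χ (conj s)) = completedLFunction χ⁻¹ s := by
  have h1 : Differentiable ℂ fun s => conj (completedLFunction χ (conj s)) := fun s => by
    have := (differentiable_completedLFunction hχ (conj s)).conj_conj
    rwa [Complex.conj_conj] at this
  have h2 := differentiable_completedLFunction (inv_ne_one.2 hχ)
  have := AnalyticOnNhd.eq_of_eventuallyEq (𝕜 := ℂ)
    (f := fun s => conj (completedLFunction χ (conj s))) (g := completedLFunction χ⁻¹) (z₀ := 2)
    (fun z _ => h1.analyticAt z) (fun z _ => h2.analyticAt z) (by
      have hV : {z | 1 < z.re} ∈ 𝓝 (2 : ℂ) :=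
        (Complex.continuous_re.isOpen_preimage _ isOpen_Ioi).mem_nhds (by simp)
      filter_upwards [hV] with z hz
      have hz' : 1 < z.re := hz
      rw [completedLFunction_eq_mul hχ (by simp; linarith),
        completedLFunction_eq_mul (inv_ne_one.2 hχ) (by linarith), map_mul,
        conj_LFunction_conj_of_one_lt_re χ hz', conj_gammaFactor_conj])
  exact congrFun this s

/-- Functional equation as a reflection in the critical line. -/
lemma IsPrimitive.completedLFunction_eq_conj {χ : DirichletCharacter ℂ q} (hχ : χ.IsPrimitive)
    (hχ1 : χ ≠ 1) (s : ℂ) : completedLFunction χ s =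
      (q : ℂ) ^ (1 / 2 - s) * rootNumber χ * conj (completedLFunction χ (1 - conj s)) := by
  have h := hχ.completedLFunction_one_sub (1 - s)
  rw [sub_sub_cancel, ← conj_completedLFunction_conj hχ1] at h
  rw [h, show 1 - s - 1 / 2 = 1 / 2 - s by ring, map_sub, map_one]

lemma completedLFunction_ne_zero_of_one_le_re {χ : DirichletCharacter ℂ q} (hχ : χ ≠ 1) {s : ℂ}
    (hs : 1 ≤ s.re) : completedLFunction χ s ≠ 0 := by
  rw [completedLFunction_eq_mul hχ (by linarith)]
  exact mul_ne_zero (LFunction_ne_zero_of_one_le_re χ (.inl hχ) hs)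
    (gammaFactor_ne_zero χ (by linarith))

/-- A vanishing root number would force a zero at `s = 1`; no Gauss sum is evaluated. -/
lemma IsPrimitive.rootNumber_ne_zero {χ : DirichletCharacter ℂ q} (hχ : χ.IsPrimitive)
    (hχ1 : χ ≠ 1) : rootNumber χ ≠ 0 := by
  intro h
  refine completedLFunction_ne_zero_of_one_le_re hχ1 (s := 1) (by simp) ?_
  rw [hχ.completedLFunction_eq_conj hχ1, h]
  simp

lemma IsPrimitive.completedLFunction_eq_zero_iff {χ : DirichletCharacter ℂ q}
    (hχ : χ.IsPrimitive) (hχ1 : χ ≠ 1) (s : ℂ) :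
    completedLFunction χ s = 0 ↔ completedLFunction χ (1 - conj s) = 0 := by
  rw [hχ.completedLFunction_eq_conj hχ1 s]
  simp [hχ.rootNumber_ne_zero hχ1, Complex.cpow_eq_zero_iff, NeZero.ne q]

end DirichletCharacter

lemma hasDerivAt_conj_one_sub_conj {F : ℂ → ℂ} {s : ℂ}
    (hF : DifferentiableAt ℂ F (1 - conj s)) :
    HasDerivAt (fun z => conj (F (1 - conj z)))
      (-conj (deriv F (1 - conj s))) s := by
  have h : HasDerivAt (fun z => F (1 - z)) (-deriv F (1 - conj s)) (conj s) := by
    simpa using hF.hasDerivAt.comp_const_sub 1 (conj s)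
  have := h.conj_conj
  rw [Complex.conj_conj, map_neg] at this
  exact this

/-- The reflection turns the local factor `(z - (1 - conj s)) ^ n` into `(-1) ^ n * (z - s) ^ n`. -/
lemma analyticOrderAt_conj_one_sub_conj {F : ℂ → ℂ} {s : ℂ}
    (hF : AnalyticAt ℂ F (1 - conj s))
    (hord : analyticOrderAt F (1 - conj s) ≠ ⊤) :
    analyticOrderAt (fun z => conj (F (1 - conj z))) s =
      analyticOrderAt F (1 - conj s) := by
  have hcont : Tendsto (fun z : ℂ => 1 - conj z) (𝓝 s) (𝓝 (1 - conj s)) :=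
    (continuous_const.sub Complex.continuous_conj).tendsto s
  have hrefl : ∀ g : ℂ → ℂ, AnalyticAt ℂ g (1 - conj s) →
      AnalyticAt ℂ (fun z => conj (g (1 - conj z))) s := by
    intro g hg
    rw [Complex.analyticAt_iff_eventually_differentiableAt] at hg ⊢
    filter_upwards [hcont.eventually hg] with z hz
    exact (hasDerivAt_conj_one_sub_conj hz).differentiableAt
  obtain ⟨g, hg, hg0, hgF⟩ := hF.analyticOrderAt_ne_top.1 hord
  rw [← Nat.cast_analyticOrderNatAt hord, (hrefl F hF).analyticOrderAt_eq_natCast]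
  set n := analyticOrderNatAt F (1 - conj s)
  refine ⟨fun z => (-1) ^ n * conj (g (1 - conj z)),
    analyticAt_const.mul (hrefl g hg), ?_, ?_⟩
  · simpa using hg0
  · filter_upwards [hcont.eventually hgF] with z hz
    rw [hz]
    simp only [smul_eq_mul, map_mul, map_pow, map_sub, map_one, Complex.conj_conj]
    rw [← mul_assoc, ← mul_pow]
    congr 2
    ring

namespace DirichletCharacter

variable {q : ℕ} [NeZero q] {χ : DirichletCharacter ℂ q}

lemma IsPrimitive.analyticOrderNatAt_completedLFunction (hχ : χ.IsPrimitive) (hχ1 : χ ≠ 1) (s : ℂ) :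
    analyticOrderNatAt (completedLFunction χ) s =
      analyticOrderNatAt (completedLFunction χ) (1 - conj s) := by
  have hF := differentiable_completedLFunction hχ1
  have hord : analyticOrderAt (completedLFunction χ) (1 - conj s) ≠ ⊤ := fun e => by
    have := (AnalyticOnNhd.analyticOrderAt_eq_top_iff_eq_zero _
        (f := completedLFunction χ) (fun z => hF.analyticAt z)).1 e
    exact completedLFunction_ne_zero_of_one_le_re hχ1 (s := 1) (by simp) (by simp [this])
  have hE : AnalyticAt ℂ (fun z : ℂ => (q : ℂ) ^ (1 / 2 - z) * rootNumber χ) s := by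
    refine Differentiable.analyticAt (fun z => ?_) s
    exact ((((differentiable_const _).sub differentiable_id) z).const_cpow
      (.inl (NeZero.ne _))).mul_const _
  have hE0 : (q : ℂ) ^ (1 / 2 - s) * rootNumber χ ≠ 0 :=
    mul_ne_zero (by simp [Complex.cpow_eq_zero_iff, NeZero.ne q]) (hχ.rootNumber_ne_zero hχ1)
  have hG : AnalyticAt ℂ (fun z => conj (completedLFunction χ (1 - conj z))) s :=
    Differentiable.analyticAt (fun z => (hasDerivAt_conj_one_sub_conj (hF _)).differentiableAt) s
  have h := analyticOrderAt_mul hE hG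
  rw [hE.analyticOrderAt_eq_zero.2 hE0, zero_add,
    analyticOrderAt_conj_one_sub_conj (hF.analyticAt _) hord] at h
  rw [analyticOrderNatAt, analyticOrderNatAt, ← h]
  congr 2
  exact funext fun z => hχ.completedLFunction_eq_conj hχ1 z

/-- Logarithmic differentiation of the reflected functional equation; `-log q` comes from the factor
`q ^ (1/2 - s)`. -/
lemma IsPrimitive.logDeriv_completedLFunction (hχ : χ.IsPrimitive) (hχ1 : χ ≠ 1) {s : ℂ}
    (hs : completedLFunction χ s ≠ 0) : logDeriv (completedLFunction χ) s =
      -Real.log q - conj (logDeriv (completedLFunction χ) (1 - conj s)) := by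
  have hF := differentiable_completedLFunction hχ1
  have hq0 : (q : ℂ) ≠ 0 := NeZero.ne _
  have hE0 : (q : ℂ) ^ (1 / 2 - s) * rootNumber χ ≠ 0 :=
    mul_ne_zero (by simp [Complex.cpow_eq_zero_iff, NeZero.ne q]) (hχ.rootNumber_ne_zero hχ1)
  have hG0 : conj (completedLFunction χ (1 - conj s)) ≠ 0 := fun h =>
    hs ((hχ.completedLFunction_eq_zero_iff hχ1 s).2 (by simpa using h))
  have hE : HasDerivAt (fun z : ℂ => (q : ℂ) ^ (1 / 2 - z) * rootNumber χ)
      ((q : ℂ) ^ (1 / 2 - s) * Complex.log q * (-1) * rootNumber χ) s :=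
    (((hasDerivAt_id s).const_sub (1 / 2)).const_cpow (.inl hq0)).mul_const _
  have hG := hasDerivAt_conj_one_sub_conj (hF (1 - conj s))
  have h : logDeriv (completedLFunction χ) s = logDeriv (fun z : ℂ =>
      ((q : ℂ) ^ (1 / 2 - z) * rootNumber χ) * conj (completedLFunction χ (1 - conj z))) s := by
    congr 1
    exact funext fun z => hχ.completedLFunction_eq_conj hχ1 z
  rw [h, logDeriv_mul s hE0 hG0 hE.differentiableAt hG.differentiableAt, logDeriv_apply,
    logDeriv_apply, logDeriv_apply, hE.deriv, hG.deriv, map_div₀, Complex.natCast_log]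
  have hlog : (q : ℂ) ^ (1 / 2 - s) * Complex.log q * -1 * rootNumber χ /
      ((q : ℂ) ^ (1 / 2 - s) * rootNumber χ) = -Complex.log q := by
    rw [div_eq_iff hE0]
    ring
  rw [hlog, neg_div, ← sub_eq_add_neg]

/-- The real part of the logarithmic derivative of the completed `L`-function at a real point, as a
sum over zeros. -/
theorem IsPrimitive.tendsto_sum_zeros_re (hχ : χ.IsPrimitive) (hχ1 : χ ≠ 1)
    {Z : ℕ → Finset ℂ} (hZ : ∀ n ρ, ρ ∈ Z n ↔ completedLFunction χ ρ = 0 ∧ ‖ρ - 1 / 2‖ ≤ n)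
    {x : ℝ} (hx : completedLFunction χ x ≠ 0) :
    Tendsto (fun n => ∑ ρ ∈ Z n,
      (analyticOrderNatAt (completedLFunction χ) ρ : ℝ) * (1 / ((x : ℂ) - ρ)).re) atTop
      (𝓝 ((logDeriv (completedLFunction χ) x).re + Real.log q / 2)) := by
  set F := completedLFunction χ with hFdef
  have hF : Differentiable ℂ F := differentiable_completedLFunction hχ1
  obtain ⟨C, hC, hgrowth⟩ := exists_norm_completedLFunction_le_exp hχ hχ1
  have hx' : F (1 - x) ≠ 0 := by
    have := (hχ.completedLFunction_eq_zero_iff hχ1 x).not.1 hx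
    simpa using this
  have hlim := (Complex.continuous_re.tendsto _).comp
    (tendsto_sum_zeros_logDeriv hF hC hgrowth hZ hx hx')
  -- The second base point is `1 - x`, the mirror image of `x`, so the unknown constant drops out
  -- and the real parts double.
  have hre : (logDeriv F x - logDeriv F (1 - x)).re
      = 2 * ((logDeriv F x).re + Real.log q / 2) := by
    have h := congrArg Complex.re (hχ.logDeriv_completedLFunction hχ1 hx)
    rw [Complex.conj_ofReal] at h
    simp only [Complex.sub_re, Complex.neg_re, Complex.ofReal_re, Complex.conj_re] at h ⊢
    linarith
  rw [hre] at hlim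
  have hlim2 := hlim.const_mul (1 / 2)
  rw [show 1 / 2 * (2 * ((logDeriv F x).re + Real.log q / 2))
    = (logDeriv F x).re + Real.log q / 2 by ring] at hlim2
  refine hlim2.congr fun n => ?_
  have hinv : ∀ ρ ∈ Z n, 1 - conj ρ ∈ Z n := by
    intro ρ hρ
    rw [hZ] at hρ ⊢
    refine ⟨(hχ.completedLFunction_eq_zero_iff hχ1 ρ).1 hρ.1, ?_⟩
    have : 1 - conj ρ - 1 / 2 = -conj (ρ - 1 / 2) := by
      simp [map_ofNat]
      ring
    rw [this, norm_neg, Complex.norm_conj]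
    exact hρ.2
  -- Discs centred at `1/2` are stable under `ρ ↦ 1 - conj ρ`, so the sum at `1 - x` is minus the
  -- sum at `x`.
  have hrefl : ∑ ρ ∈ Z n, (analyticOrderNatAt F ρ : ℝ) * (1 / ((1 : ℂ) - x - ρ)).re
      = -∑ ρ ∈ Z n, (analyticOrderNatAt F ρ : ℝ) * (1 / ((x : ℂ) - ρ)).re := by
    rw [← Finset.sum_neg_distrib]
    refine Finset.sum_bij' (fun ρ _ => 1 - conj ρ) (fun ρ _ => 1 - conj ρ) hinv hinv
      (by simp) (by simp) fun ρ _ => ?_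
    rw [← hχ.analyticOrderNatAt_completedLFunction hχ1 ρ]
    have : (1 : ℂ) - x - ρ = -conj (x - (1 - conj ρ)) := by simp; ring
    rw [this, div_neg, Complex.neg_re, one_div, one_div, ← Complex.conj_inv, Complex.conj_re]
    ring
  have hsum : ∀ w : ℂ, (∑ ρ ∈ Z n, (analyticOrderNatAt F ρ : ℂ) * (1 / (w - ρ))).re =
      ∑ ρ ∈ Z n, (analyticOrderNatAt F ρ : ℝ) * (1 / (w - ρ)).re := by
    intro w
    rw [Complex.re_sum]
    refine Finset.sum_congr rfl fun ρ _ => ?_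
    rw [← Complex.ofReal_natCast, Complex.re_ofReal_mul]
  simp only [Function.comp_apply, Complex.sub_re, hsum, hrefl]
  ring

end DirichletCharacter

/-! ### Bounds for ζ and L'/L to the right of 1. -/

lemma summable_one_div_add_one_rpow {s : ℝ} (hs : 1 < s) :
    Summable fun n : ℕ => 1 / ((n : ℝ) + 1) ^ s := by
  have := (summable_nat_add_iff 1).2 (Real.summable_one_div_nat_rpow.2 hs)
  simpa using this

lemma tsum_one_div_add_one_rpow_le {s : ℝ} (hs : 1 < s) :
    ∑' n : ℕ, 1 / ((n : ℝ) + 1) ^ s ≤ s / (s - 1) := by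
  have h1 := ZetaAsymptotics.zeta_limit_aux1 hs
  have h2 : 0 ≤ ZetaAsymptotics.termTSum s :=
    tsum_nonneg fun n => ZetaAsymptotics.term_nonneg _ _
  have h3 : s / (s - 1) = 1 + 1 / (s - 1) := by
    field_simp [(by linarith : s - 1 ≠ 0)]
    ring
  rw [h3]
  nlinarith

/-- Comparison with the integral of `x ^ (-s)`: the left side of `hstep` is its value over `[1, N +
1]`. -/
lemma le_tsum_one_div_add_one_rpow {s : ℝ} (hs : 1 < s) :
    1 / (s - 1) ≤ ∑' n : ℕ, 1 / ((n : ℝ) + 1) ^ s := by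
  have hs1 : 0 < s - 1 := by linarith
  have hstep : ∀ N : ℕ, 1 / (s - 1) * (1 - ((N : ℝ) + 1) ^ (-(s - 1))) ≤
      ∑ n ∈ Finset.range N, 1 / ((n : ℝ) + 1) ^ s := by
    intro N
    induction N with
    | zero => simp
    | succ N ih =>
      rw [Finset.sum_range_succ]
      have hN : (0:ℝ) < (N : ℝ) + 1 := by positivity
      have h1 : ((N : ℝ) + 1) ^ (-(s - 1)) * (1 - (s - 1) / ((N : ℝ) + 1)) ≤
          ((N : ℝ) + 1 + 1) ^ (-(s - 1)) := by
        have h2 : (N : ℝ) + 1 + 1 = ((N : ℝ) + 1) * (1 + 1 / ((N : ℝ) + 1)) := by field_simp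
        rw [h2, Real.mul_rpow hN.le (by positivity)]
        gcongr
        rw [Real.rpow_def_of_pos (by positivity)]
        have h3 := Real.log_le_sub_one_of_pos (show 0 < 1 + 1 / ((N : ℝ) + 1) by positivity)
        have h4 := Real.add_one_le_exp (Real.log (1 + 1 / ((N : ℝ) + 1)) * -(s - 1))
        have h5 : (s - 1) / ((N : ℝ) + 1) = (s - 1) * (1 / ((N : ℝ) + 1)) := by ring
        rw [h5]
        nlinarith
      have h6 : 1 / ((N : ℝ) + 1) ^ s =
          1 / (s - 1) * (((N : ℝ) + 1) ^ (-(s - 1)) * ((s - 1) / ((N : ℝ) + 1))) := by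
        rw [neg_sub, Real.rpow_sub hN, Real.rpow_one]
        field_simp
      rw [h6]
      push_cast
      have h7 : 0 < 1 / (s - 1) := by positivity
      nlinarith
  have hlim : Tendsto (fun N : ℕ => 1 / (s - 1) * (1 - ((N : ℝ) + 1) ^ (-(s - 1)))) atTop
      (𝓝 (1 / (s - 1) * (1 - 0))) :=
    (((tendsto_rpow_neg_atTop hs1).comp
      (tendsto_natCast_atTop_atTop.atTop_add tendsto_const_nhds)).const_sub _).const_mul _
  rw [sub_zero, mul_one] at hlim
  exact le_of_tendsto_of_tendsto' hlim (summable_one_div_add_one_rpow hs).hasSum.tendsto_sum_nat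
    hstep

lemma norm_term_one_add_one (s : ℝ) (n : ℕ) :
    ‖LSeries.term 1 (s : ℂ) (n + 1)‖ = 1 / ((n : ℝ) + 1) ^ s := by
  rw [LSeries.norm_term_eq, if_neg (by omega)]
  simp

lemma tsum_norm_term_one {s : ℝ} (hs : 1 < s) :
    ∑' n, ‖LSeries.term 1 (s : ℂ) n‖ = ∑' n : ℕ, 1 / ((n : ℝ) + 1) ^ s := by
  have h1 : Summable fun n => ‖LSeries.term (1 : ℕ → ℂ) s n‖ :=
    (LSeriesSummable_one_iff.2 (by simpa using hs)).norm
  rw [h1.tsum_eq_zero_add, LSeries.term_zero, norm_zero, zero_add]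
  exact tsum_congr (norm_term_one_add_one s)

lemma norm_LSeries_eq_tsum_norm {a : ℕ → ℝ} (ha : ∀ n, 0 ≤ a n) (s : ℝ) :
    ‖LSeries (fun n => (a n : ℂ)) s‖ = ∑' n, ‖LSeries.term (fun n => (a n : ℂ)) s n‖ := by
  have h : ∀ n, LSeries.term (fun n => (a n : ℂ)) s n =
      ((‖LSeries.term (fun n => (a n : ℂ)) s n‖ : ℝ) : ℂ) := by
    intro n
    rcases eq_or_ne n 0 with rfl | hn
    · simp
    · rw [LSeries.norm_term_eq, if_neg hn, LSeries.term_of_ne_zero hn, Complex.norm_real,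
        Real.norm_of_nonneg (ha n), Complex.ofReal_re, Complex.ofReal_div,
        Complex.ofReal_cpow (by positivity)]
      simp
  rw [LSeries, tsum_congr h, ← Complex.ofReal_tsum, Complex.norm_real,
    Real.norm_of_nonneg (tsum_nonneg fun _ => norm_nonneg _)]

/-- The inequality `log n ≤ n ^ h / (e h)` trades the logarithm for a shift of the exponent by `h`.
-/
lemma norm_deriv_LSeries_one_le {s h : ℝ} (hh : 0 < h) (hs : 1 < s - h) :
    ‖deriv (LSeries 1) (s : ℂ)‖ ≤
      1 / (Real.exp 1 * h) * ∑' n : ℕ, 1 / ((n : ℝ) + 1) ^ (s - h) := by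
  have habs : LSeries.abscissaOfAbsConv 1 < (s : ℂ).re := by
    rw [LSeries.abscissaOfAbsConv_one]
    exact_mod_cast (show 1 < s by linarith)
  rw [LSeries_deriv habs, norm_neg, LSeries, ← tsum_norm_term_one hs, ← tsum_mul_left]
  have h1 : Summable fun n => ‖LSeries.term (1 : ℕ → ℂ) (s - h : ℝ) n‖ :=
    (LSeriesSummable_one_iff.2 (by simpa using hs)).norm
  have hle : ∀ n, ‖LSeries.term (LSeries.logMul 1) s n‖ ≤
      1 / (Real.exp 1 * h) * ‖LSeries.term (1 : ℕ → ℂ) (s - h : ℝ) n‖ := by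
    intro n
    rcases n with _ | n
    · simp
    · rw [norm_term_one_add_one, LSeries.norm_term_eq, if_neg (by omega)]
      have hn : (0:ℝ) < (n : ℝ) + 1 := by positivity
      have hlog : Real.log ((n : ℝ) + 1) ≤ 1 / (Real.exp 1 * h) * ((n : ℝ) + 1) ^ h := by
        have h2 := Real.log_le_sub_one_of_pos
          (show 0 < ((n : ℝ) + 1) ^ h / Real.exp 1 by positivity)
        rw [Real.log_div (by positivity) (by positivity), Real.log_rpow hn, Real.log_exp] at h2
        have h3 : h * Real.log ((n : ℝ) + 1) ≤ ((n : ℝ) + 1) ^ h / Real.exp 1 := by linarith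
        rw [mul_comm, ← le_div_iff₀ hh] at h3
        refine h3.trans (le_of_eq ?_)
        field_simp
      have hlog0 : 0 ≤ Real.log ((n : ℝ) + 1) := Real.log_nonneg (by linarith [n.cast_nonneg (α := ℝ)])
      have hnorm : ‖LSeries.logMul 1 (n + 1)‖ = Real.log ((n : ℝ) + 1) := by
        rw [LSeries.logMul, Pi.one_apply, mul_one, ← Complex.natCast_log, Complex.norm_real]
        push_cast
        exact Real.norm_of_nonneg hlog0
      rw [hnorm, Complex.ofReal_re, Real.rpow_sub hn]
      push_cast
      calc Real.log ((n : ℝ) + 1) / ((n : ℝ) + 1) ^ s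
          ≤ (1 / (Real.exp 1 * h) * ((n : ℝ) + 1) ^ h) / ((n : ℝ) + 1) ^ s := by gcongr
        _ = _ := by field_simp
  exact (norm_tsum_le_tsum_norm ((h1.mul_left _).of_nonneg_of_le (fun _ => norm_nonneg _) hle)).trans
    (((h1.mul_left _).of_nonneg_of_le (fun _ => norm_nonneg _) hle).tsum_le_tsum hle (h1.mul_left _))

open ArithmeticFunction in
/-- Bound for the logarithmic derivative of a Dirichlet `L`-function to the right of `1`. -/
lemma DirichletCharacter.norm_logDeriv_LFunction_le {q : ℕ} [NeZero q] (χ : DirichletCharacter ℂ q)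
    {δ : ℝ} (hδ : 0 < δ) :
    ‖logDeriv (LFunction χ) ((1 + δ : ℝ) : ℂ)‖ ≤ 3 / 2 * (1 / δ + 1 / 2) := by
  set s : ℝ := 1 + δ with hs
  have hs1 : 1 < (s : ℂ).re := by simp [hs, hδ]
  have h1 : ‖logDeriv (LFunction χ) s‖ = ‖LSeries ((fun n : ℕ => χ n) * fun n => (vonMangoldt n : ℂ)) s‖ := by
    rw [LSeries_twist_vonMangoldt_eq χ hs1, logDeriv_apply, neg_div, norm_neg,
      deriv_LFunction_eq_deriv_LSeries χ hs1, LFunction_eq_LSeries χ hs1]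
  have hsum := (LSeriesSummable_vonMangoldt hs1).norm
  have hle : ∀ n, ‖LSeries.term ((fun n : ℕ => χ n) * fun n => (vonMangoldt n : ℂ)) s n‖ ≤
      ‖LSeries.term (fun n => (vonMangoldt n : ℂ)) s n‖ := fun n => by
    refine LSeries.norm_term_le s ?_
    rw [Pi.mul_apply, norm_mul]
    exact mul_le_of_le_one_left (norm_nonneg _) (χ.norm_le_one n)
  -- Since `|χ(n)| ≤ 1`, the series is dominated by that of `-ζ'/ζ`.
  have h2 : ‖LSeries ((fun n : ℕ => χ n) * fun n => (vonMangoldt n : ℂ)) s‖ ≤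
      ‖LSeries (fun n => (vonMangoldt n : ℂ)) s‖ := by
    rw [norm_LSeries_eq_tsum_norm (fun n => vonMangoldt_nonneg)]
    exact (norm_tsum_le_tsum_norm (hsum.of_nonneg_of_le (fun _ => norm_nonneg _) hle)).trans
      ((hsum.of_nonneg_of_le (fun _ => norm_nonneg _) hle).tsum_le_tsum hle hsum)
  have h3 : ‖LSeries (1 : ℕ → ℂ) s‖ = ∑' n : ℕ, 1 / ((n : ℝ) + 1) ^ s := by
    rw [← tsum_norm_term_one (by linarith)]
    have h := norm_LSeries_eq_tsum_norm (a := fun _ => 1) (fun _ => zero_le_one) s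
    rw [Complex.ofReal_one] at h
    exact h
  -- The shift `δ / 2` balances the factors `1 / h` and `1 / (δ - h)`; with `e ≥ 8/3` below, `4 / e`
  -- becomes the constant `3/2`.
  have h4 := norm_deriv_LSeries_one_le (s := s) (h := δ / 2) (by positivity) (by linarith)
  have h5 := tsum_one_div_add_one_rpow_le (s := s - δ / 2) (by linarith)
  have h6 := le_tsum_one_div_add_one_rpow (s := s) (by linarith)
  have h7 : ‖LSeries (fun n => (vonMangoldt n : ℂ)) s‖ =
      ‖deriv (LSeries 1) (s : ℂ)‖ / ‖LSeries (1 : ℕ → ℂ) s‖ := by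
    rw [LSeries_vonMangoldt_eq hs1, norm_div, norm_neg]
  rw [h1]
  refine h2.trans ?_
  rw [h7, h3]
  have he : 8 / 3 ≤ Real.exp 1 := by linarith [Real.exp_one_gt_d9]
  have hsd : s - 1 = δ := by rw [hs]; ring
  have hsd' : s - δ / 2 - 1 = δ / 2 := by rw [hs]; ring
  rw [hsd] at h6
  rw [hsd'] at h5
  calc _ ≤ (1 / (Real.exp 1 * (δ / 2)) * ((s - δ / 2) / (δ / 2))) / (1 / δ) := by
        have h8 : ‖deriv (LSeries 1) (s : ℂ)‖ ≤
            1 / (Real.exp 1 * (δ / 2)) * ((s - δ / 2) / (δ / 2)) :=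
          h4.trans (mul_le_mul_of_nonneg_left h5 (by positivity))
        exact div_le_div₀ ((norm_nonneg _).trans h8) h8 (by positivity) h6
    _ ≤ (1 / (8 / 3 * (δ / 2)) * ((s - δ / 2) / (δ / 2))) / (1 / δ) := by
        have : 0 < s - δ / 2 := by linarith
        gcongr
    _ = 3 / 2 * (1 / δ + 1 / 2) := by
        rw [hs]
        field_simp
        ring

/-! ### Digamma and the gamma factor. -/

lemma hasDerivAt_log_Gamma {y : ℝ} (hy : 0 < y) :
    HasDerivAt (Real.log ∘ Real.Gamma) (Complex.digamma y).re y := by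
  have hd : DifferentiableAt ℂ Complex.Gamma (y : ℂ) := Complex.differentiableAt_Gamma _ fun m h => by
    have : y = -m := by exact_mod_cast h
    linarith [m.cast_nonneg (α := ℝ)]
  have h1 : HasDerivAt Real.Gamma (deriv Complex.Gamma (y : ℂ)).re y := hd.hasDerivAt.real_of_complex
  have h2 := h1.log (Real.Gamma_pos_of_pos hy).ne'
  refine h2.congr_deriv ?_
  rw [Complex.digamma_def, logDeriv_apply, Complex.Gamma_ofReal, Complex.div_ofReal_re]

lemma digamma_re_mono {x y : ℝ} (hx : 0 < x) (hxy : x < y) :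
    (Complex.digamma x).re ≤ (Complex.digamma y).re :=
  (Real.convexOn_log_Gamma.le_slope_of_hasDerivAt hx (hx.trans hxy) hxy
    (hasDerivAt_log_Gamma hx)).trans
  (Real.convexOn_log_Gamma.slope_le_of_hasDerivAt hx (hx.trans hxy) hxy
    (hasDerivAt_log_Gamma (hx.trans hxy)))

/-- By convexity of `log Γ` this slope lies between the derivatives at the endpoints: `ψ(y) ≤ log y
≤ ψ(y + 1) = ψ(y) + 1 / y`. -/
lemma slope_log_Gamma {y : ℝ} (hy : 0 < y) :
    slope (Real.log ∘ Real.Gamma) y (y + 1) = Real.log y := by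
  rw [slope_def_field, Function.comp_apply, Function.comp_apply, Real.Gamma_add_one hy.ne',
    Real.log_mul hy.ne' (Real.Gamma_pos_of_pos hy).ne']
  ring

lemma digamma_re_le_log {y : ℝ} (hy : 0 < y) : (Complex.digamma y).re ≤ Real.log y := by
  have hy1 : 0 < y + 1 := by linarith
  rw [← slope_log_Gamma hy]
  exact Real.convexOn_log_Gamma.le_slope_of_hasDerivAt hy hy1 (by linarith)
    (hasDerivAt_log_Gamma hy)

lemma log_sub_inv_le_digamma_re {y : ℝ} (hy : 0 < y) :
    Real.log y - 1 / y ≤ (Complex.digamma y).re := by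
  have hy1 : 0 < y + 1 := by linarith
  have h1 : Real.log y ≤ (Complex.digamma ((y + 1 : ℝ) : ℂ)).re := by
    rw [← slope_log_Gamma hy]
    exact Real.convexOn_log_Gamma.slope_le_of_hasDerivAt hy hy1 (by linarith)
      (hasDerivAt_log_Gamma hy1)
  rw [Complex.ofReal_add, Complex.ofReal_one, Complex.digamma_apply_add_one _ fun m h => by
    have : y = -m := by exact_mod_cast h
    linarith [m.cast_nonneg (α := ℝ)]] at h1
  rw [Complex.add_re, ← Complex.ofReal_inv, Complex.ofReal_re, inv_eq_one_div] at h1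
  linarith

lemma differentiableAt_Gammaℝ {s : ℂ} (hs : 0 < s.re) : DifferentiableAt ℂ Complex.Gammaℝ s := by
  have h := (Complex.differentiable_Gammaℝ_inv s).inv
    (inv_ne_zero (Complex.Gammaℝ_ne_zero_of_re_pos hs))
  rwa [show (fun s => (Complex.Gammaℝ s)⁻¹)⁻¹ = Complex.Gammaℝ from funext fun s => inv_inv _] at h

lemma logDeriv_Gammaℝ_re {x : ℝ} (hx : 0 < x) :
    (logDeriv Complex.Gammaℝ x).re = -Real.log Real.pi / 2 + (Complex.digamma ((x / 2 : ℝ) : ℂ)).re / 2 := by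
  have hpi : (Real.pi : ℂ) ≠ 0 := by exact_mod_cast Real.pi_ne_zero
  have h1 : HasDerivAt (fun s : ℂ => (Real.pi : ℂ) ^ (-s / 2))
      ((Real.pi : ℂ) ^ (-(x : ℂ) / 2) * Complex.log Real.pi * (-1 / 2)) x :=
    (((hasDerivAt_id (x : ℂ)).neg).div_const 2).const_cpow (.inl hpi)
  have hx2 : ((x / 2 : ℝ) : ℂ) = (x : ℂ) / 2 := by push_cast; rfl
  have hd : DifferentiableAt ℂ Complex.Gamma ((x : ℂ) / 2) :=
    Complex.differentiableAt_Gamma _ fun m h => by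
      have : x / 2 = -m := by exact_mod_cast h
      linarith [m.cast_nonneg (α := ℝ)]
  have h2 : HasDerivAt (fun s : ℂ => Complex.Gamma (s / 2))
      (deriv Complex.Gamma ((x : ℂ) / 2) * (1 / 2)) x :=
    hd.hasDerivAt.comp (x : ℂ) ((hasDerivAt_id (x : ℂ)).div_const 2)
  have h3 : Complex.Gamma ((x : ℂ) / 2) ≠ 0 := Complex.Gamma_ne_zero_of_re_pos (by simp [hx])
  have h4 : (Real.pi : ℂ) ^ (-(x : ℂ) / 2) ≠ 0 := by simp [Complex.cpow_eq_zero_iff, hpi]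
  have h5 : Complex.Gammaℝ = fun s => (Real.pi : ℂ) ^ (-s / 2) * Complex.Gamma (s / 2) :=
    funext Complex.Gammaℝ_def
  rw [h5, logDeriv_mul (x : ℂ) h4 h3 h1.differentiableAt h2.differentiableAt, logDeriv_apply,
    logDeriv_apply, h1.deriv, h2.deriv, hx2, Complex.digamma_def, logDeriv_apply, mul_assoc,
    mul_div_cancel_left₀ _ h4, ← Complex.ofReal_log Real.pi_pos.le,
    show (-1 / 2 : ℂ) = ((-1 / 2 : ℝ) : ℂ) by push_cast; rfl, ← Complex.ofReal_mul,
    Complex.add_re, Complex.ofReal_re, mul_div_right_comm,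
    show (1 / 2 : ℂ) = ((1 / 2 : ℝ) : ℂ) by push_cast; rfl, Complex.re_mul_ofReal]
  ring

namespace DirichletCharacter

variable {q : ℕ}

lemma differentiableAt_gammaFactor (χ : DirichletCharacter ℂ q) {s : ℂ} (hs : 0 < s.re) :
    DifferentiableAt ℂ (gammaFactor χ) s := by
  rcases χ.even_or_odd with h | h
  · rw [funext h.gammaFactor_def]
    exact differentiableAt_Gammaℝ hs
  · rw [funext h.gammaFactor_def]
    exact DifferentiableAt.comp (g := Complex.Gammaℝ) s
      (differentiableAt_Gammaℝ (by simp; linarith)) (by fun_prop)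

/-- The parity is `a`, either 0 or 1; later bounds use only `0 ≤ a ≤ 1`. -/
lemma exists_logDeriv_gammaFactor_re (χ : DirichletCharacter ℂ q) : ∃ a : ℝ, 0 ≤ a ∧ a ≤ 1 ∧
    ∀ x : ℝ, 0 < x → (logDeriv (gammaFactor χ) x).re =
      -Real.log Real.pi / 2 + (Complex.digamma (((x + a) / 2 : ℝ) : ℂ)).re / 2 := by
  rcases χ.even_or_odd with h | h
  · refine ⟨0, le_rfl, zero_le_one, fun x hx => ?_⟩
    rw [funext h.gammaFactor_def, logDeriv_Gammaℝ_re hx, add_zero]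
  · refine ⟨1, zero_le_one, le_rfl, fun x hx => ?_⟩
    rw [funext h.gammaFactor_def, ← logDeriv_Gammaℝ_re (by linarith), logDeriv_apply, logDeriv_apply,
      deriv_comp_add_const]
    push_cast
    rfl

/-- Here `ψ(y) ≤ log y ≤ log π` because `y = (x + a) / 2 ≤ 3/2`. The gamma factor can thus be
dropped from upper bounds. -/
lemma logDeriv_gammaFactor_re_nonpos (χ : DirichletCharacter ℂ q) {x : ℝ} (hx : 0 < x) (hx2 : x ≤ 2) :
    (logDeriv (gammaFactor χ) x).re ≤ 0 := by
  obtain ⟨a, ha0, ha1, h⟩ := χ.exists_logDeriv_gammaFactor_re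
  rw [h x hx]
  have h1 := digamma_re_le_log (y := (x + a) / 2) (by linarith)
  have h2 := Real.log_le_log (x := (x + a) / 2) (y := Real.pi) (by linarith)
    (by linarith [Real.pi_gt_three])
  linarith

lemma abs_logDeriv_gammaFactor_re_sub_le (χ : DirichletCharacter ℂ q) {x : ℝ} (hx : 1 < x) :
    |(logDeriv (gammaFactor χ) x).re - (logDeriv (gammaFactor χ) 1).re| ≤ 1 + (x - 1) / 2 := by
  obtain ⟨a, ha0, ha1, h⟩ := χ.exists_logDeriv_gammaFactor_re
  have hone := h 1 one_pos
  rw [Complex.ofReal_one] at hone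
  rw [h x (by linarith), hone]
  have h1 := digamma_re_le_log (y := (x + a) / 2) (by linarith)
  have h2 := log_sub_inv_le_digamma_re (y := (1 + a) / 2) (by linarith)
  have h3 := digamma_re_mono (x := (1 + a) / 2) (y := (x + a) / 2) (by linarith) (by linarith)
  have h4 : Real.log ((x + a) / 2) - Real.log ((1 + a) / 2) ≤ x - 1 := by
    rw [← Real.log_div (by linarith) (by linarith)]
    refine (Real.log_le_sub_one_of_pos (div_pos (by linarith) (by linarith))).trans ?_
    rw [div_sub_one (by linarith), div_le_iff₀ (by linarith)]
    nlinarith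
  have h5 : 1 / ((1 + a) / 2) ≤ 2 := by
    rw [div_le_iff₀ (by linarith)]
    linarith
  rw [abs_le]
  constructor <;> linarith

end DirichletCharacter

/-! ### The contribution of a single zero. -/

lemma one_div_ofReal_sub_re (x : ℝ) (ρ : ℂ) :
    (1 / ((x : ℂ) - ρ)).re = (x - ρ.re) / ((x - ρ.re) ^ 2 + ρ.im ^ 2) := by
  rw [one_div, Complex.inv_re, Complex.normSq_apply]
  simp [sq]

lemma one_div_ofReal_sub_re_nonneg {x : ℝ} {ρ : ℂ} (h : ρ.re ≤ x) : 0 ≤ (1 / ((x : ℂ) - ρ)).re := by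
  rw [one_div_ofReal_sub_re]
  exact div_nonneg (by linarith) (by positivity)

lemma one_div_ofReal_sub_re_le {x : ℝ} {ρ : ℂ} (h : ρ.re < x) :
    (1 / ((x : ℂ) - ρ)).re ≤ 1 / (x - ρ.re) := by
  have : 0 < x - ρ.re := by linarith
  rw [one_div_ofReal_sub_re, div_le_div_iff₀ (by positivity) this]
  nlinarith [sq_nonneg ρ.im]

/-- Moving the base point changes the contribution of a zero outside the box only slightly. -/
lemma abs_one_div_sub_re_sub_le {ρ : ℂ} {δ r : ℝ} (hρ : ρ.re < 1) (hδ : 0 < δ) (hr : 0 < r)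
    (hout : ρ.re ≤ 1 - 1 / r ^ 2 ∨ 1 / r ≤ |ρ.im|) :
    |(1 / (((1 : ℝ) : ℂ) - ρ)).re - (1 / (((1 + δ : ℝ) : ℂ) - ρ)).re| ≤
      δ * r ^ 2 * (1 / (((1 + δ : ℝ) : ℂ) - ρ)).re
        + 2 * δ * r * (1 / (((1 + 1 / r : ℝ) : ℂ) - ρ)).re := by
  have h1 : 0 < 1 / r := by positivity
  have hn1 := one_div_ofReal_sub_re_nonneg (x := 1 + δ) (ρ := ρ) (by linarith)
  have hn2 := one_div_ofReal_sub_re_nonneg (x := 1 + 1 / r) (ρ := ρ) (by linarith)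
  have hn1' : 0 ≤ δ * r ^ 2 * (1 / (((1 + δ : ℝ) : ℂ) - ρ)).re := by positivity
  have hn2' : 0 ≤ 2 * δ * r * (1 / (((1 + 1 / r : ℝ) : ℂ) - ρ)).re := by positivity
  obtain ⟨u, hu⟩ : ∃ u, u = 1 - ρ.re := ⟨_, rfl⟩
  have hu0 : 0 < u := by linarith
  set t := ρ.im
  have e0 : (1 / (((1 : ℝ) : ℂ) - ρ)).re = u / (u ^ 2 + t ^ 2) := by
    rw [one_div_ofReal_sub_re, ← hu]
  have e1 : (1 / (((1 + δ : ℝ) : ℂ) - ρ)).re = (u + δ) / ((u + δ) ^ 2 + t ^ 2) := by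
    rw [one_div_ofReal_sub_re, show 1 + δ - ρ.re = u + δ by rw [hu]; ring]
  have e2 : (1 / (((1 + 1 / r : ℝ) : ℂ) - ρ)).re = (u + 1 / r) / ((u + 1 / r) ^ 2 + t ^ 2) := by
    rw [one_div_ofReal_sub_re, show 1 + 1 / r - ρ.re = u + 1 / r by rw [hu]; ring]
  have hP : 0 < u ^ 2 + t ^ 2 := by positivity
  have hQ : 0 < (u + δ) ^ 2 + t ^ 2 := by positivity
  have hW : 0 < (u + 1 / r) ^ 2 + t ^ 2 := by positivity
  have hdiff : u / (u ^ 2 + t ^ 2) - (u + δ) / ((u + δ) ^ 2 + t ^ 2) =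
      δ * (u * (u + δ) - t ^ 2) / ((u ^ 2 + t ^ 2) * ((u + δ) ^ 2 + t ^ 2)) := by
    field_simp
    ring
  have habs : |u / (u ^ 2 + t ^ 2) - (u + δ) / ((u + δ) ^ 2 + t ^ 2)| ≤
      δ * (u * (u + δ) + t ^ 2) / ((u ^ 2 + t ^ 2) * ((u + δ) ^ 2 + t ^ 2)) := by
    rw [hdiff, abs_div, abs_of_pos (mul_pos hP hQ), abs_mul, abs_of_pos hδ]
    gcongr
    have : 0 ≤ u * (u + δ) := by positivity
    rw [abs_le]
    constructor <;> nlinarith [sq_nonneg t]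
  rcases hout with hout | hout
  · refine le_trans ?_ (le_add_of_nonneg_right hn2')
    rw [e0, e1]
    refine habs.trans ?_
    -- Left of the box, the factor `r² u ≥ 1` pays for the comparison with the point `1 + δ`.
    have hru : 1 ≤ r ^ 2 * u := by
      have : 1 / r ^ 2 ≤ u := by linarith
      rwa [div_le_iff₀' (by positivity)] at this
    rw [← mul_div_assoc, div_le_div_iff₀ (by positivity) hQ]
    have h2 : u * (u + δ) ≤ (r ^ 2 * u) * (u * (u + δ)) :=
      le_mul_of_one_le_left (by positivity) hru
    have h3 : t ^ 2 ≤ (r ^ 2 * u) * t ^ 2 := le_mul_of_one_le_left (by positivity) hru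
    have h4 : 0 ≤ r ^ 2 * δ * t ^ 2 := by positivity
    have h5 : u * (u + δ) + t ^ 2 ≤ r ^ 2 * (u + δ) * (u ^ 2 + t ^ 2) := by linarith
    calc δ * (u * (u + δ) + t ^ 2) * ((u + δ) ^ 2 + t ^ 2)
        ≤ δ * (r ^ 2 * (u + δ) * (u ^ 2 + t ^ 2)) * ((u + δ) ^ 2 + t ^ 2) := by gcongr
      _ = _ := by ring
  · refine le_trans ?_ (le_add_of_nonneg_left hn1')
    rw [e0, e1, e2]
    refine habs.trans ?_
    have h2 : δ * (u * (u + δ) + t ^ 2) / ((u ^ 2 + t ^ 2) * ((u + δ) ^ 2 + t ^ 2)) ≤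
        δ / (u ^ 2 + t ^ 2) := by
      rw [div_le_div_iff₀ (by positivity) hP]
      have : u * (u + δ) + t ^ 2 ≤ (u + δ) ^ 2 + t ^ 2 := by nlinarith
      nlinarith [mul_le_mul_of_nonneg_left this (mul_pos hδ hP).le]
    refine h2.trans ?_
    set η := 1 / r with hη
    have hrη : r * η = 1 := by rw [hη]; field_simp
    have ht : η ^ 2 ≤ t ^ 2 := by
      rw [← sq_abs t]
      exact pow_le_pow_left₀ h1.le hout 2
    rw [← mul_div_assoc, div_le_div_iff₀ hP hW]
    -- Here `u` may be tiny, and comparison at `1 + δ` would cost too much; at the more distant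
    -- point `1 + η` the bound `|t| ≥ η` suffices.
    have h3 : (u + η) ^ 2 + t ^ 2 ≤ 2 * (1 + r * u) * (u ^ 2 + t ^ 2) := by
      have h4 : 0 ≤ r * u * u ^ 2 := by positivity
      have h5 : r * u * η ^ 2 ≤ r * u * t ^ 2 := by gcongr
      have h6 : r * u * η ^ 2 = u * η := by
        rw [show r * u * η ^ 2 = (r * η) * (u * η) by ring, hrη, one_mul]
      nlinarith [sq_nonneg u]
    calc δ * ((u + η) ^ 2 + t ^ 2) ≤ δ * (2 * (1 + r * u) * (u ^ 2 + t ^ 2)) := by gcongr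
      _ = 2 * δ * (r * η + r * u) * (u ^ 2 + t ^ 2) := by rw [hrη]; ring
      _ = _ := by ring

/-- The numerical inequality behind the constant `14.5`. -/
lemma error_terms_lt {r w : ℝ} (hr : 1.41 ≤ r) (hw : 1 ≤ w) (hrw : r ≤ 2 * w) :
    1 / (r * w) * r ^ 2 * (w ^ 2 / 2 + 3 / 2 * (r * w + 1 / 2))
      + 2 * (1 / (r * w)) * r * (w ^ 2 / 2 + 3 / 2 * (r + 1 / 2))
      + 3 / 2 * (r * w + 1 / 2) + (1 + 1 / (r * w) / 2) < 14.5 * (r * w) := by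
  have hr0 : 0 < r := by linarith
  have hw0 : 0 < w := by linarith
  have h1 : 1 / (r * w) * r ^ 2 * (w ^ 2 / 2 + 3 / 2 * (r * w + 1 / 2)) =
      r * w / 2 + 3 / 2 * r ^ 2 + 3 / 4 * (r / w) := by
    field_simp
    ring
  have h2 : 2 * (1 / (r * w)) * r * (w ^ 2 / 2 + 3 / 2 * (r + 1 / 2)) =
      w + 3 * (r / w) + 3 / 2 * (1 / w) := by
    field_simp
    ring
  rw [h1, h2]
  -- The hypothesis `f ≤ 4 log q` enters as `r ≤ 2w`. Multiples of `r w` then total about 5.71, and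
  -- the constants total 11.25, at most `7.98 r w`; the sum stays below `13.7 r w`.
  have h3 : r / w ≤ 2 := by rwa [div_le_iff₀ hw0]
  have h4 : 1 / w ≤ 1 := by rwa [div_le_iff₀ hw0, one_mul]
  have hX : 1.41 ≤ r * w := by nlinarith
  have h5 : 1 / (r * w) ≤ 1 := by
    rw [div_le_iff₀ (by positivity)]
    linarith
  have h6 : r ^ 2 ≤ 2 * (r * w) := by nlinarith
  have h7 : 1.41 * w ≤ r * w := by gcongr
  linarith

/-! ### Primitive characters, comparison of the two points, and conclusion. -/

namespace DirichletCharacter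

variable {q : ℕ} [NeZero q] {χ : DirichletCharacter ℂ q}

lemma IsPrimitive.ne_one (hχ : χ.IsPrimitive) (hq : 2 ≤ q) : χ ≠ 1 := by
  rintro rfl
  have h : conductor (1 : DirichletCharacter ℂ q) = q := hχ
  rw [conductor_one] at h
  omega

/-- Modulo 2 the only character is trivial. The bound ensures `log q ≥ 1`. -/
lemma IsPrimitive.three_le (hχ : χ.IsPrimitive) (hq : 2 ≤ q) : 3 ≤ q := by
  by_contra! h
  obtain rfl : q = 2 := by omega
  refine hχ.ne_one hq (MulChar.ext fun u => ?_)
  rw [Subsingleton.elim u 1]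
  simp

lemma logDeriv_completedLFunction_eq (hχ : χ ≠ 1) {s : ℂ} (hs : 1 ≤ s.re) :
    logDeriv (completedLFunction χ) s =
      logDeriv (LFunction χ) s + logDeriv (gammaFactor χ) s := by
  have hs0 : 0 < s.re := by linarith
  rw [← logDeriv_mul s (LFunction_ne_zero_of_one_le_re χ (.inl hχ) hs) (gammaFactor_ne_zero χ hs0)
    (differentiable_LFunction hχ s) (differentiableAt_gammaFactor χ hs0)]
  have h : completedLFunction χ =ᶠ[𝓝 s] fun z => LFunction χ z * gammaFactor χ z := by
    filter_upwards [(isOpen_lt continuous_const Complex.continuous_re).mem_nhds hs0] with z hz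
    exact completedLFunction_eq_mul hχ hz
  rw [logDeriv_apply, logDeriv_apply, h.deriv_eq, h.self_of_nhds]

lemma analyticOrderNatAt_completedLFunction_eq (hχ : χ ≠ 1) {s : ℂ} (hs : 0 < s.re) :
    analyticOrderNatAt (completedLFunction χ) s = analyticOrderNatAt (LFunction χ) s := by
  have h : completedLFunction χ =ᶠ[𝓝 s] LFunction χ * gammaFactor χ := by
    filter_upwards [(isOpen_lt continuous_const Complex.continuous_re).mem_nhds hs] with z hz
    exact completedLFunction_eq_mul hχ hz
  have hγ : AnalyticAt ℂ (gammaFactor χ) s := by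
    rw [Complex.analyticAt_iff_eventually_differentiableAt]
    filter_upwards [(isOpen_lt continuous_const Complex.continuous_re).mem_nhds hs] with z hz
    exact differentiableAt_gammaFactor χ hz
  rw [analyticOrderNatAt, analyticOrderNatAt, analyticOrderAt_congr h,
    analyticOrderAt_mul ((differentiable_LFunction hχ).analyticAt s) hγ,
    hγ.analyticOrderAt_eq_zero.2 (gammaFactor_ne_zero χ hs), add_zero]

/-- Nonvanishing on `Re s ≥ 1` reflects to `Re s ≤ 0`; inside the strip the gamma factor has no
zeros. -/
lemma IsPrimitive.completedLFunction_eq_zero_iff_mem (hχ : χ.IsPrimitive) (hχ1 : χ ≠ 1) {s : ℂ} :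
    completedLFunction χ s = 0 ↔ s ∈ nontrivialZeros χ := by
  constructor
  · intro h
    have h1 : s.re < 1 := by
      by_contra! h1
      exact completedLFunction_ne_zero_of_one_le_re hχ1 h1 h
    have h0 : 0 < s.re := by
      by_contra! h0
      exact completedLFunction_ne_zero_of_one_le_re hχ1 (by simp; linarith)
        ((hχ.completedLFunction_eq_zero_iff hχ1 s).1 h)
    rw [completedLFunction_eq_mul hχ1 h0] at h
    exact ⟨h0, h1, (mul_eq_zero.1 h).resolve_right (gammaFactor_ne_zero χ h0)⟩
  · rintro ⟨h0, _, h⟩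
    rw [completedLFunction_eq_mul hχ1 h0, h, zero_mul]

end DirichletCharacter

namespace DirichletCharacter

variable {q : ℕ} [NeZero q] {χ : DirichletCharacter ℂ q}

lemma finite_nontrivialZeros_inter_regionB (hχ : χ ≠ 1) {f : ℕ → ℝ} (hf : 2 ≤ f q) :
    (nontrivialZeros χ ∩ regionB f q).Finite := by
  have hF := differentiable_LFunction hχ
  have hF0 : LFunction χ ≠ 0 := fun h =>
    LFunction_ne_zero_of_one_le_re χ (.inl hχ) (s := 1) (by simp) (by rw [h]; rfl)
  refine (finite_zeros_of_isBounded hF hF0 (isBounded_closedBall (x := 0) (r := 2))).subset ?_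
  rintro ρ ⟨⟨h0, h1, hz⟩, _, him⟩
  refine ⟨hz, ?_⟩
  rw [mem_closedBall, dist_zero_right]
  have h2 : 1 / √(f q) ≤ 1 := by
    rw [div_le_one (by positivity), Real.one_le_sqrt]
    linarith
  have h3 : |ρ.re| ≤ 1 := abs_le.2 ⟨by linarith, h1.le⟩
  linarith [Complex.norm_le_abs_re_add_abs_im ρ]

/-- Upper bound for the sum over zeros of a completed `L`-function at a real point of `(1, 2]`. -/
lemma logDeriv_completedLFunction_re_le (hχ1 : χ ≠ 1) {δ : ℝ}
    (hδ : 0 < δ) (hδ1 : δ ≤ 1) :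
    (logDeriv (completedLFunction χ) ((1 + δ : ℝ) : ℂ)).re + Real.log q / 2 ≤
      Real.log q / 2 + 3 / 2 * (1 / δ + 1 / 2) := by
  rw [logDeriv_completedLFunction_eq hχ1 (by simp [hδ.le]), Complex.add_re]
  have h1 := (Complex.re_le_norm _).trans (χ.norm_logDeriv_LFunction_le hδ)
  have h2 := χ.logDeriv_gammaFactor_re_nonpos (x := 1 + δ) (by linarith) (by linarith)
  linarith

/-- Comparison of the sums over zeros outside the box at two points. -/
lemma IsPrimitive.abs_logDeriv_completedLFunction_re_sub_le (hχ : χ.IsPrimitive) (hχ1 : χ ≠ 1)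
    {f : ℕ → ℝ} (hf : 2 ≤ f q) (hfin : (nontrivialZeros χ ∩ regionB f q).Finite) {δ : ℝ}
    (hδ : 0 < δ) :
    |(logDeriv (completedLFunction χ) ((1 : ℝ) : ℂ)).re - (logDeriv (completedLFunction χ) ((1 + δ : ℝ) : ℂ)).re
      - ∑ ρ ∈ hfin.toFinset, (zeroMultiplicity χ ρ : ℝ) *
        ((1 / (((1 : ℝ) : ℂ) - ρ)).re - (1 / (((1 + δ : ℝ) : ℂ) - ρ)).re)| ≤
      δ * √(f q) ^ 2 * ((logDeriv (completedLFunction χ) ((1 + δ : ℝ) : ℂ)).re + Real.log q / 2)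
      + 2 * δ * √(f q) * ((logDeriv (completedLFunction χ) ((1 + 1 / √(f q) : ℝ) : ℂ)).re
        + Real.log q / 2) := by
  set F := completedLFunction χ with hFdef
  have hF : Differentiable ℂ F := differentiable_completedLFunction hχ1
  have hne : ∀ {x : ℝ}, 1 ≤ x → F x ≠ 0 := fun hx =>
    completedLFunction_ne_zero_of_one_le_re hχ1 (by simpa using hx)
  have hF0 : F ≠ 0 := fun h => hne le_rfl (by rw [h]; rfl)
  have hr : 0 < √(f q) := Real.sqrt_pos.2 (by linarith)
  have hbd : ∀ n : ℕ, ({z | F z = 0} ∩ closedBall (1 / 2) (n : ℝ)).Finite := fun n =>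
    finite_zeros_of_isBounded hF hF0 isBounded_closedBall
  obtain ⟨Z, hZ⟩ : ∃ Z : ℕ → Finset ℂ, ∀ n ρ, ρ ∈ Z n ↔ F ρ = 0 ∧ ‖ρ - 1 / 2‖ ≤ n :=
    ⟨fun n => (hbd n).toFinset, fun n ρ => by simp [dist_eq_norm]⟩
  have hlim : ∀ {x : ℝ}, 1 ≤ x → Tendsto (fun n => ∑ ρ ∈ Z n,
      (analyticOrderNatAt F ρ : ℝ) * (1 / ((x : ℂ) - ρ)).re) atTop
      (𝓝 ((logDeriv F x).re + Real.log q / 2)) := fun hx =>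
    hχ.tendsto_sum_zeros_re hχ1 hZ (hne hx)
  have hmem : ∀ {ρ}, F ρ = 0 → ρ ∈ nontrivialZeros χ := (hχ.completedLFunction_eq_zero_iff_mem hχ1).1
  have hl1 := hlim (x := 1) le_rfl
  have hl2 := hlim (x := 1 + δ) (by linarith)
  have hl3 := hlim (x := 1 + 1 / √(f q)) (by linarith [one_div_pos.2 hr])
  have hT : ∀ ρ ∈ hfin.toFinset, zeroMultiplicity χ ρ = analyticOrderNatAt F ρ := by
    intro ρ hρ
    have h := (hfin.mem_toFinset.1 hρ).1.1
    rw [zeroMultiplicity, analyticOrderNatAt_completedLFunction_eq hχ1 h]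
  have hleft := ((hl1.sub hl2).sub_const (∑ ρ ∈ hfin.toFinset, (zeroMultiplicity χ ρ : ℝ) *
        ((1 / (((1 : ℝ) : ℂ) - ρ)).re - (1 / (((1 + δ : ℝ) : ℂ) - ρ)).re))).abs
  -- The two terms `log q / 2` cancel.
  rw [add_sub_add_right_eq_sub] at hleft
  refine le_of_tendsto_of_tendsto hleft ((hl2.const_mul _).add (hl3.const_mul _)) ?_
  obtain ⟨N, hN⟩ : ∃ N : ℕ, ∀ ρ ∈ hfin.toFinset, ‖ρ - 1 / 2‖ ≤ N := by
    refine ⟨⌈∑ ρ ∈ hfin.toFinset, ‖ρ - 1 / 2‖⌉₊, fun ρ hρ => ?_⟩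
    exact (Finset.single_le_sum (f := fun ρ : ℂ => ‖ρ - 1 / 2‖) (fun _ _ => norm_nonneg _) hρ).trans
      (Nat.le_ceil _)
  filter_upwards [eventually_ge_atTop N] with n hn
  have hsub : hfin.toFinset ⊆ Z n := fun ρ hρ => (hZ n ρ).2
    ⟨(hχ.completedLFunction_eq_zero_iff_mem hχ1).2 (hfin.mem_toFinset.1 hρ).1,
      (hN ρ hρ).trans (by exact_mod_cast hn)⟩
  have hmult : ∑ ρ ∈ hfin.toFinset, (zeroMultiplicity χ ρ : ℝ) *
        ((1 / (((1 : ℝ) : ℂ) - ρ)).re - (1 / (((1 + δ : ℝ) : ℂ) - ρ)).re) =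
      ∑ ρ ∈ hfin.toFinset, (analyticOrderNatAt F ρ : ℝ) *
        ((1 / (((1 : ℝ) : ℂ) - ρ)).re - (1 / (((1 + δ : ℝ) : ℂ) - ρ)).re) :=
    Finset.sum_congr rfl fun ρ hρ => by rw [hT ρ hρ]
  rw [hmult, ← Finset.sum_sub_distrib]
  simp only [← mul_sub]
  rw [← Finset.sum_sdiff hsub, add_sub_cancel_right, Finset.mul_sum, Finset.mul_sum,
    ← Finset.sum_add_distrib]
  refine (Finset.abs_sum_le_sum_abs _ _).trans ?_
  -- Nonnegativity allows the majorant to be summed over all zeros, including those in the box, so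
  -- that its limit is known.
  have hnn : ∀ ρ ∈ Z n, 0 ≤ δ * √(f q) ^ 2 * ((analyticOrderNatAt F ρ : ℝ) *
      (1 / (((1 + δ : ℝ) : ℂ) - ρ)).re) + 2 * δ * √(f q) * ((analyticOrderNatAt F ρ : ℝ) *
      (1 / (((1 + 1 / √(f q) : ℝ) : ℂ) - ρ)).re) := by
    intro ρ hρ
    have h1 : ρ.re < 1 := (hmem ((hZ n ρ).1 hρ).1).2.1
    have h2 := one_div_ofReal_sub_re_nonneg (x := 1 + δ) (ρ := ρ) (by linarith)
    have h3 := one_div_ofReal_sub_re_nonneg (x := 1 + 1 / √(f q)) (ρ := ρ)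
      (by linarith [one_div_pos.2 hr])
    positivity
  refine le_trans (Finset.sum_le_sum fun ρ hρ => ?_)
    (Finset.sum_le_sum_of_subset_of_nonneg Finset.sdiff_subset fun ρ hρ _ => hnn ρ hρ)
  rw [Finset.mem_sdiff, hZ, hfin.mem_toFinset] at hρ
  have hρz := hmem hρ.1.1
  have hout : ρ.re ≤ 1 - 1 / √(f q) ^ 2 ∨ 1 / √(f q) ≤ |ρ.im| := by
    rw [Real.sq_sqrt (by linarith)]
    by_contra! h
    exact hρ.2 ⟨hρz, h⟩
  rw [abs_mul, Nat.abs_cast]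
  calc _ ≤ (analyticOrderNatAt F ρ : ℝ) * (δ * √(f q) ^ 2 * (1 / (((1 + δ : ℝ) : ℂ) - ρ)).re
        + 2 * δ * √(f q) * (1 / (((1 + 1 / √(f q) : ℝ) : ℂ) - ρ)).re) := by
        gcongr
        exact abs_one_div_sub_re_sub_le hρz.2.1 hδ hr hout
    _ = _ := by ring

end DirichletCharacter

open DirichletCharacter in
theorem mainTheorem8 (f : ℕ → ℝ)
    (hf : ∀ n : ℕ, 2 ≤ n → 2 ≤ f n ∧ f n ≤ 4 * Real.log n)
    (q : ℕ) [NeZero q] (hq : 2 ≤ q) (χ : DirichletCharacter ℂ q) (hχ : χ.IsPrimitive) :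
    ∃ hfin : (nontrivialZeros χ ∩ regionB f q).Finite,
      |(deriv (DirichletCharacter.LFunction χ) 1 / DirichletCharacter.LFunction χ 1
          - ∑ ρ ∈ hfin.toFinset, (zeroMultiplicity χ ρ : ℂ) * (1 / (1 - ρ))).re|
        < (14.5 + 2 * ((∑ ρ ∈ hfin.toFinset, zeroMultiplicity χ ρ : ℕ) : ℝ))
            * Real.sqrt (f q * Real.log q) := by
  obtain ⟨hf2, hf4⟩ := hf q hq
  have hχ1 := hχ.ne_one hq
  have hfin := finite_nontrivialZeros_inter_regionB hχ1 hf2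
  refine ⟨hfin, ?_⟩
  have hlog : 1 ≤ Real.log q := by
    have h3 : (3 : ℝ) ≤ q := by exact_mod_cast hχ.three_le hq
    rw [Real.le_log_iff_exp_le (by linarith)]
    linarith [Real.exp_one_lt_d9]
  set r := √(f q) with hr
  set w := √(Real.log q) with hw
  have hr1 : 1.41 ≤ r := Real.le_sqrt_of_sq_le (by norm_num; linarith)
  have hw1 : 1 ≤ w := Real.one_le_sqrt.2 hlog
  have hw2 : w ^ 2 = Real.log q := Real.sq_sqrt (by linarith)
  have hr2 : r ^ 2 = f q := Real.sq_sqrt (by linarith)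
  have hrw : r ≤ 2 * w := by
    refine (Real.sqrt_le_left (by linarith)).2 ?_
    rw [mul_pow, hw2]
    linarith
  have hsqrt : √(f q * Real.log q) = r * w := Real.sqrt_mul (by linarith) _
  have hX : 1.41 ≤ r * w := by nlinarith
  -- This choice balances `1 / δ` against `δ f log q`.
  set δ := 1 / (r * w) with hδ
  have hδ0 : 0 < δ := by positivity
  have hδ1 : δ ≤ 1 := by
    rw [hδ, div_le_one (by linarith)]
    linarith
  have hinv : 1 / δ = r * w := by rw [hδ, one_div_one_div]
  have hη1 : 1 / r ≤ 1 := by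
    rw [div_le_one (by linarith)]
    linarith
  have hcomp := hχ.abs_logDeriv_completedLFunction_re_sub_le hχ1 hf2 hfin hδ0
  have hS0 := logDeriv_completedLFunction_re_le hχ1 hδ0 hδ1
  have hS1 := logDeriv_completedLFunction_re_le hχ1 (δ := 1 / r) (by positivity) hη1
  rw [← hw2, hinv] at hS0
  rw [← hw2, one_div_one_div] at hS1
  have hmain := error_terms_lt hr1 hw1 hrw
  rw [← hδ] at hmain
  have hL := (Complex.abs_re_le_norm _).trans (χ.norm_logDeriv_LFunction_le hδ0)
  rw [hinv] at hL
  have hγ := χ.abs_logDeriv_gammaFactor_re_sub_le (x := 1 + δ) (by linarith)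
  rw [add_sub_cancel_left] at hγ
  -- Each zero in the box costs at most `1 / δ`, so one copy of the count suffices; `hNX` supplies
  -- the second.
  have hB : |∑ ρ ∈ hfin.toFinset, (zeroMultiplicity χ ρ : ℝ) * (1 / (((1 + δ : ℝ) : ℂ) - ρ)).re| ≤
      ((∑ ρ ∈ hfin.toFinset, zeroMultiplicity χ ρ : ℕ) : ℝ) * (r * w) := by
    rw [Nat.cast_sum, Finset.sum_mul]
    refine (Finset.abs_sum_le_sum_abs _ _).trans (Finset.sum_le_sum fun ρ hρ => ?_)
    have hρ1 : ρ.re < 1 := (hfin.mem_toFinset.1 hρ).1.2.1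
    rw [abs_mul, Nat.abs_cast, abs_of_nonneg (one_div_ofReal_sub_re_nonneg (by linarith))]
    gcongr
    refine (one_div_ofReal_sub_re_le (by linarith)).trans ?_
    rw [← hinv]
    exact one_div_le_one_div_of_le hδ0 (by linarith)
  -- The box terms at 1 and at `1 + δ` are added and removed, so that each summand matches one of
  -- `hcomp`, `hL`, `hγ`, `hB`.
  have hsplit : (deriv (LFunction χ) 1 / LFunction χ 1
      - ∑ ρ ∈ hfin.toFinset, (zeroMultiplicity χ ρ : ℂ) * (1 / (1 - ρ))).re =
      ((logDeriv (completedLFunction χ) ((1 : ℝ) : ℂ)).re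
        - (logDeriv (completedLFunction χ) ((1 + δ : ℝ) : ℂ)).re
        - ∑ ρ ∈ hfin.toFinset, (zeroMultiplicity χ ρ : ℝ) *
          ((1 / (((1 : ℝ) : ℂ) - ρ)).re - (1 / (((1 + δ : ℝ) : ℂ) - ρ)).re))
      + (logDeriv (LFunction χ) ((1 + δ : ℝ) : ℂ)).re
      + ((logDeriv (gammaFactor χ) ((1 + δ : ℝ) : ℂ)).re - (logDeriv (gammaFactor χ) 1).re)
      - ∑ ρ ∈ hfin.toFinset, (zeroMultiplicity χ ρ : ℝ) * (1 / (((1 + δ : ℝ) : ℂ) - ρ)).re := by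
    have hsum : (∑ ρ ∈ hfin.toFinset, (zeroMultiplicity χ ρ : ℂ) * (1 / (1 - ρ))).re =
        ∑ ρ ∈ hfin.toFinset, (zeroMultiplicity χ ρ : ℝ) * (1 / (((1 : ℝ) : ℂ) - ρ)).re := by
      rw [Complex.re_sum]
      refine Finset.sum_congr rfl fun ρ _ => ?_
      rw [← Complex.ofReal_natCast, Complex.re_ofReal_mul, Complex.ofReal_one]
    have hone : logDeriv (completedLFunction χ) ((1 : ℝ) : ℂ) =
        logDeriv (LFunction χ) 1 + logDeriv (gammaFactor χ) 1 := by
      rw [Complex.ofReal_one]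
      exact logDeriv_completedLFunction_eq hχ1 (by simp)
    rw [hone,
      logDeriv_completedLFunction_eq hχ1 (s := ((1 + δ : ℝ) : ℂ)) (by simp [hδ0.le]),
      Complex.sub_re, hsum, ← logDeriv_apply, Complex.add_re, Complex.add_re]
    simp only [mul_sub, Finset.sum_sub_distrib]
    ring
  have hNX : 0 ≤ ((∑ ρ ∈ hfin.toFinset, zeroMultiplicity χ ρ : ℕ) : ℝ) * (r * w) := by positivity
  have hc1 := mul_le_mul_of_nonneg_left hS0 (show 0 ≤ δ * r ^ 2 by positivity)
  have hc2 := mul_le_mul_of_nonneg_left hS1 (show 0 ≤ 2 * δ * r by positivity)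
  rw [← hw2] at hcomp
  rw [hsqrt, hsplit, add_mul, mul_assoc 2]
  rw [abs_le] at hcomp hL hγ hB
  rw [abs_lt]
  constructor <;> linarith
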